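/- **Theorem.** Let $\Bbbk$ be a field of characteristic $0$, let $A$ be a commutative $\Bbbk$-algebra, and let $\mathcal H=(\mathcal H_l,\mathcal H_r,S)$ be a (not necessarily commutative) Hopf algebroid, in the sense of Böhm, whose left and right base algebras are both $A$. That is, $\mathcal H$ is a left bialgebroid $(s_l,t_l,\Delta_l,\varepsilon_l)$ with $a\triangleright h\triangleleft b=s_l(a)t_l(b)h$ and a right bialgebroid $(s_r,t_r,\Delta_r,\varepsilon_r)$ with $a\blacktriangleright h\blacktriangleleft b=h\,t_r(a)s_r(b)$, such that $s_l\varepsilon_lt_r=t_r$, $t_l\varepsilon_ls_r=s_r$, $s_r\varepsilon_rt_l=t_l$, $t_r\varepsilon_rs_l=s_l$; the mixed coassociativity laws $(\Delta_l\otimes\mathrm{id})\Delta_r=(\mathrm{id}\otimes\Delta_r)\Delta_l$ and $(\Delta_r\otimes\mathrm{id})\Delta_l=(\mathrm{id}\otimes\Delta_l)\Delta_r$ hold; and $S:\mathcal H\to\mathcal H$ is $\Bbbk$-linear with $S(t_l(a)\,h\,t_r(b))=s_r(b)S(h)s_l(a)$, $S(h_{(1)})h_{(2)}=s_r\varepsilon_r(h)$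 and $h^{(1)}S(h^{(2)})=s_l\varepsilon_l(h)$, where $\Delta_l(h)=h_{(1)}\otimes h_{(2)}$ and $\Delta_r(h)=h^{(1)}\otimes h^{(2)}$. Assume that $s_l=t_r=:t$ and $s_r=t_l=:s$. A *local biretraction* of $\mathcal H$ is a $\Bbbk$-linear multiplicative (not necessarily unital) map $\alpha:\mathcal H\to A$ such that $\alpha(s(a))=a\,\alpha(1_{\mathcal H})$ for all $a\in A$, and such that there is $e^\alpha\in A$ with $\alpha(t(e^\alpha))=\alpha(1_{\mathcal H})$ for which $\alpha\circ t$ restricts to a bijection $Ae^\alpha\to A\,\alpha(1_{\mathcal H})$. Let $\mathfrak{Brt}(\mathcal H,A)$ be the set of local biretractions, and write $(\alpha\circ t)^{-1}:A\,\alpha(1_{\mathcal H})\to Ae^\alpha$ for the inverse of this bijection. Then the formulas $$(\alpha*\beta)(h)=\beta\big(\alpha(h_{(1)})\triangleright h_{(2)}\big),\qquad \alpha^*(h)=(\alpha\circ t)^{-1}\Big(\alpha\big(S(\varepsilon_l(h^{(1)})\triangleright h^{(2)})\big)\Big)$$ are well defined (independent of the chosen representatives of $\Delta_l(h)$ and $\Delta_r(h)$)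 and give, respectively, an associative product and a self-map $\alpha\mapsto\alpha^*$ on $\mathfrak{Brt}(\mathcal H,A)$. Let $\mathfrak B(\mathcal H)=\Bbbk\,\mathfrak{Brt}(\mathcal H,A)$ be the free vector space on $\mathfrak{Brt}(\mathcal H,A)$, with product the bilinear extension of $*$, and let $\underline\Delta$ and $\mathcal S$ be the linear maps on $\mathfrak B(\mathcal H)$ with $\underline\Delta(\alpha)=\alpha\otimes\alpha$ and $\mathcal S(\alpha)=\alpha^*$ for every $\alpha\in\mathfrak{Brt}(\mathcal H,A)$. Then $(\mathfrak B(\mathcal H),\underline\Delta,\mathcal S)$ is a quantum inverse semigroup. That is, $\mathfrak B(\mathcal H)$ is an associative (not necessarily unital) $\Bbbk$-algebra, $\underline\Delta$ is multiplicative and coassociative, $\mathcal S$ is antimultiplicative, $I*\mathcal S*I=I$ and $\mathcal S*I*\mathcal S=\mathcal S$ for the convolution product of $\mathrm{End}_{\Bbbk}(\mathfrak B(\mathcal H))$, and, with $\underline\Delta(x)=x_{(1)}\otimes x_{(2)}$, $$x_{(1)}\mathcal S(x_{(2)})\,\mathcal S(y_{(1)})y_{(2)}=\mathcal S(y_{(1)})y_{(2)}\,x_{(1)}\mathcal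 S(x_{(2)})\qquad\text{for all }x,y\in\mathfrak B(\mathcal H).$$ -/

import Mathlib

open scoped TensorProduct
open MulOpposite

noncomputable section

/-! ### Tensor products over a not necessarily commutative base -/

section Balanced

variable {𝕜 A B M N P : Type*} [Field 𝕜]
  [AddCommGroup M] [Module 𝕜 M] [AddCommGroup N] [Module 𝕜 N] [AddCommGroup P] [Module 𝕜 P]

/-- The relations `(m ◁ a) ⊗ n = m ⊗ (a ▷ n)`, where `ρ a m = m ◁ a` and `l a n = a ▷ n`. -/
def balancedRel (ρ : A → M →ₗ[𝕜] M) (l : A → N →ₗ[𝕜] N) : Submodule 𝕜 (M ⊗[𝕜] N) :=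
  Submodule.span 𝕜 {z | ∃ a m n, z = ρ a m ⊗ₜ[𝕜] n - m ⊗ₜ[𝕜] l a n}

/-- The tensor product `M ⊗_A N` of the right action `ρ` on `M` and the left action `l` on `N`,
as the quotient of `M ⊗_𝕜 N` by the balancing relations. -/
abbrev BalancedTensor (ρ : A → M →ₗ[𝕜] M) (l : A → N →ₗ[𝕜] N) : Type _ :=
  (M ⊗[𝕜] N) ⧸ balancedRel ρ l

/-- The relations defining `M ⊗_A N ⊗_B P`. -/
def balancedRel₃ (ρ : A → M →ₗ[𝕜] M) (l : A → N →ₗ[𝕜] N)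
    (ρ' : B → N →ₗ[𝕜] N) (l' : B → P →ₗ[𝕜] P) : Submodule 𝕜 (M ⊗[𝕜] (N ⊗[𝕜] P)) :=
  Submodule.span 𝕜
    ({z | ∃ a m n p, z = ρ a m ⊗ₜ[𝕜] (n ⊗ₜ[𝕜] p) - m ⊗ₜ[𝕜] (l a n ⊗ₜ[𝕜] p)} ∪
     {z | ∃ b m n p, z = m ⊗ₜ[𝕜] (ρ' b n ⊗ₜ[𝕜] p) - m ⊗ₜ[𝕜] (n ⊗ₜ[𝕜] l' b p)})

/-- The triple tensor product `M ⊗_A N ⊗_B P`. -/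
abbrev BalancedTensor₃ (ρ : A → M →ₗ[𝕜] M) (l : A → N →ₗ[𝕜] N)
    (ρ' : B → N →ₗ[𝕜] N) (l' : B → P →ₗ[𝕜] P) : Type _ :=
  (M ⊗[𝕜] (N ⊗[𝕜] P)) ⧸ balancedRel₃ ρ l ρ' l'

/-- The canonical map `(M ⊗_A N) ⊗_𝕜 P → M ⊗_A N ⊗_B P`, `[m ⊗ n] ⊗ p ↦ [m ⊗ n ⊗ p]`. -/
def toTripleLeft (ρ : A → M →ₗ[𝕜] M) (l : A → N →ₗ[𝕜] N)
    (ρ' : B → N →ₗ[𝕜] N) (l' : B → P →ₗ[𝕜] P) :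
    BalancedTensor ρ l ⊗[𝕜] P →ₗ[𝕜] BalancedTensor₃ ρ l ρ' l' :=
  TensorProduct.lift <| (balancedRel ρ l).liftQ
    (TensorProduct.curry
      ((balancedRel₃ ρ l ρ' l').mkQ ∘ₗ (TensorProduct.assoc 𝕜 M N P).toLinearMap)) <| by
    refine Submodule.span_le.2 ?_
    rintro _ ⟨a, m, n, rfl⟩
    rw [SetLike.mem_coe, LinearMap.mem_ker]
    ext p
    simp only [map_sub, LinearMap.sub_apply, TensorProduct.curry_apply, LinearMap.comp_apply,
      LinearEquiv.coe_coe, TensorProduct.assoc_tmul, LinearMap.zero_apply]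
    rw [← map_sub, Submodule.mkQ_apply, Submodule.Quotient.mk_eq_zero]
    exact Submodule.subset_span (Or.inl ⟨a, m, n, p, rfl⟩)

/-- The canonical map `M ⊗_𝕜 (N ⊗_B P) → M ⊗_A N ⊗_B P`, `m ⊗ [n ⊗ p] ↦ [m ⊗ n ⊗ p]`. -/
def toTripleRight (ρ : A → M →ₗ[𝕜] M) (l : A → N →ₗ[𝕜] N)
    (ρ' : B → N →ₗ[𝕜] N) (l' : B → P →ₗ[𝕜] P) :
    M ⊗[𝕜] BalancedTensor ρ' l' →ₗ[𝕜] BalancedTensor₃ ρ l ρ' l' :=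
  TensorProduct.lift <| LinearMap.flip <| (balancedRel ρ' l').liftQ
    (LinearMap.flip (TensorProduct.curry (balancedRel₃ ρ l ρ' l').mkQ)) <| by
    refine Submodule.span_le.2 ?_
    rintro _ ⟨b, n, p, rfl⟩
    rw [SetLike.mem_coe, LinearMap.mem_ker]
    ext m
    simp only [map_sub, LinearMap.sub_apply, TensorProduct.curry_apply, LinearMap.flip_apply,
      LinearMap.zero_apply]
    rw [← map_sub, ← TensorProduct.tmul_sub, Submodule.mkQ_apply, Submodule.Quotient.mk_eq_zero,
      TensorProduct.tmul_sub]
    exact Submodule.subset_span (Or.inr ⟨b, m, n, p, rfl⟩)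

end Balanced

/-! ### Bialgebroids and Hopf algebroids

An element `x : H ⊗[𝕜] H` with `mkQ x = Δ h` is a representative `∑ h₁ ⊗ h₂` of `Δ h` in the
quotient `H ⊗_A H`. Every `Δ h` has a representative, and axioms involving `h₁ ⊗ h₂` are required
for all representatives. -/

section Bialgebroids

variable (𝕜 A B H : Type*) [Field 𝕜] [Ring A] [Algebra 𝕜 A] [Ring B] [Algebra 𝕜 B]
  [Ring H] [Algebra 𝕜 H]

variable {𝕜 A H} in
/-- Left multiplication on `H` by the elements `f a`. -/
def leftMulBy (f : A → H) (a : A) : H →ₗ[𝕜] H := LinearMap.mulLeft 𝕜 (f a)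

variable {𝕜 A H} in
/-- Right multiplication on `H` by the elements `f a`. -/
def rightMulBy (f : A → H) (a : A) : H →ₗ[𝕜] H := LinearMap.mulRight 𝕜 (f a)

/-- A left bialgebroid over `A` with total algebra `H`. The `A`-bimodule structure of `H` is
`a ▷ h ◁ b = s a * t b * h`; the antimorphism `t : A → H` is given as a morphism on `Aᵐᵒᵖ`. -/
structure LeftBialgebroid where
  s : A →ₐ[𝕜] H
  t : Aᵐᵒᵖ →ₐ[𝕜] H
  s_t_comm : ∀ a b, s a * t (op b) = t (op b) * s a
  /-- The comultiplication `H → H ⊗_A H`. -/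
  comul : H →ₗ[𝕜] BalancedTensor (𝕜 := 𝕜) (leftMulBy fun a => t (op a)) (leftMulBy s)
  counit : H →ₗ[𝕜] A
  -- the comultiplication and the counit are `A`-bimodule maps
  comul_bimod : ∀ a b h x, Submodule.mkQ _ x = comul h →
    comul (s a * t (op b) * h) = Submodule.mkQ _ ((s a ⊗ₜ[𝕜] t (op b)) * x)
  counit_bimod : ∀ a b h, counit (s a * t (op b) * h) = a * counit h * b
  -- `(Δ ⊗_A H) ∘ Δ = (H ⊗_A Δ) ∘ Δ` in `H ⊗_A H ⊗_A H`
  coassoc : ∀ h x y, Submodule.mkQ _ x = comul h → Submodule.mkQ _ y = comul h →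
    toTripleLeft _ _ (leftMulBy fun a => t (op a)) (leftMulBy s)
        (TensorProduct.map comul LinearMap.id x) =
      toTripleRight (leftMulBy fun a => t (op a)) (leftMulBy s) _ _
        (TensorProduct.map LinearMap.id comul y)
  -- `ε(h₁) ▷ h₂ = h` and `h₁ ◁ ε(h₂) = h`
  counit_left : ∀ h x, Submodule.mkQ _ x = comul h →
    LinearMap.mul' 𝕜 H (TensorProduct.map (s.toLinearMap ∘ₗ counit) LinearMap.id x) = h
  counit_right : ∀ h x, Submodule.mkQ _ x = comul h →
    LinearMap.mul' 𝕜 H (TensorProduct.comm 𝕜 H H (TensorProduct.map LinearMap.id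
      (t.toLinearMap ∘ₗ (opLinearEquiv 𝕜).toLinearMap ∘ₗ counit) x)) = h
  -- the image of `Δ` lies in the Takeuchi product
  comul_takeuchi : ∀ a h x, Submodule.mkQ _ x = comul h →
    Submodule.mkQ (balancedRel (𝕜 := 𝕜) (leftMulBy fun a => t (op a)) (leftMulBy s))
      (x * (t (op a) ⊗ₜ[𝕜] 1)) = Submodule.mkQ _ (x * (1 ⊗ₜ[𝕜] s a))
  -- `Δ` is an algebra morphism into the Takeuchi product
  comul_one : comul 1 = Submodule.mkQ _ (1 ⊗ₜ[𝕜] 1)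
  comul_mul : ∀ h g x y, Submodule.mkQ _ x = comul h → Submodule.mkQ _ y = comul g →
    comul (h * g) = Submodule.mkQ _ (x * y)
  counit_mul_s : ∀ h g, counit (h * g) = counit (h * s (counit g))
  counit_mul_t : ∀ h g, counit (h * g) = counit (h * t (op (counit g)))

/-- A right bialgebroid over `A` with total algebra `H`. The `A`-bimodule structure of `H` is
`a ▶ h ◀ b = h * t a * s b`; the antimorphism `t : A → H` is given as a morphism on `Aᵐᵒᵖ`. -/
structure RightBialgebroid where
  s : A →ₐ[𝕜] H
  t : Aᵐᵒᵖ →ₐ[𝕜] H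
  s_t_comm : ∀ a b, s a * t (op b) = t (op b) * s a
  /-- The comultiplication `H → H ⊗_A H`. -/
  comul : H →ₗ[𝕜] BalancedTensor (𝕜 := 𝕜) (rightMulBy s) (rightMulBy fun a => t (op a))
  counit : H →ₗ[𝕜] A
  -- the comultiplication and the counit are `A`-bimodule maps
  comul_bimod : ∀ a b h x, Submodule.mkQ _ x = comul h →
    comul (h * t (op a) * s b) = Submodule.mkQ _ (x * (t (op a) ⊗ₜ[𝕜] s b))
  counit_bimod : ∀ a b h, counit (h * t (op a) * s b) = a * counit h * b
  -- `(Δ ⊗_A H) ∘ Δ = (H ⊗_A Δ) ∘ Δ` in `H ⊗_A H ⊗_A H`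
  coassoc : ∀ h x y, Submodule.mkQ _ x = comul h → Submodule.mkQ _ y = comul h →
    toTripleLeft _ _ (rightMulBy s) (rightMulBy fun a => t (op a))
        (TensorProduct.map comul LinearMap.id x) =
      toTripleRight (rightMulBy s) (rightMulBy fun a => t (op a)) _ _
        (TensorProduct.map LinearMap.id comul y)
  -- `ε(h₁) ▶ h₂ = h` and `h₁ ◀ ε(h₂) = h`
  counit_left : ∀ h x, Submodule.mkQ _ x = comul h →
    LinearMap.mul' 𝕜 H (TensorProduct.comm 𝕜 H H (TensorProduct.map
      (t.toLinearMap ∘ₗ (opLinearEquiv 𝕜).toLinearMap ∘ₗ counit) LinearMap.id x)) = h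
  counit_right : ∀ h x, Submodule.mkQ _ x = comul h →
    LinearMap.mul' 𝕜 H (TensorProduct.map LinearMap.id (s.toLinearMap ∘ₗ counit) x) = h
  -- the image of `Δ` lies in the Takeuchi product
  comul_takeuchi : ∀ a h x, Submodule.mkQ _ x = comul h →
    Submodule.mkQ (balancedRel (𝕜 := 𝕜) (rightMulBy s) (rightMulBy fun a => t (op a)))
      ((s a ⊗ₜ[𝕜] 1) * x) = Submodule.mkQ _ ((1 ⊗ₜ[𝕜] t (op a)) * x)
  -- `Δ` is an algebra morphism into the Takeuchi product
  comul_one : comul 1 = Submodule.mkQ _ (1 ⊗ₜ[𝕜] 1)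
  comul_mul : ∀ h g x y, Submodule.mkQ _ x = comul h → Submodule.mkQ _ y = comul g →
    comul (h * g) = Submodule.mkQ _ (x * y)
  counit_mul_s : ∀ h g, counit (h * g) = counit (s (counit h) * g)
  counit_mul_t : ∀ h g, counit (h * g) = counit (t (op (counit h)) * g)

/-- A Hopf algebroid over the base algebras `A` and `B`, with total algebra `H`. -/
structure HopfAlgebroid where
  l : LeftBialgebroid 𝕜 A H
  r : RightBialgebroid 𝕜 B H
  /-- The antipode. -/
  S : H →ₗ[𝕜] H
  sl_tr : ∀ b, l.s (l.counit (r.t (op b))) = r.t (op b)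
  tl_sr : ∀ b, l.t (op (l.counit (r.s b))) = r.s b
  sr_tl : ∀ a, r.s (r.counit (l.t (op a))) = l.t (op a)
  tr_sl : ∀ a, r.t (op (r.counit (l.s a))) = l.s a
  -- `(Δ_l ⊗_B H) ∘ Δ_r = (H ⊗_A Δ_r) ∘ Δ_l` in `H ⊗_A H ⊗_B H`
  coassoc_lr : ∀ h x y, Submodule.mkQ _ x = r.comul h → Submodule.mkQ _ y = l.comul h →
    toTripleLeft _ _ (rightMulBy r.s) (rightMulBy fun b => r.t (op b))
        (TensorProduct.map l.comul LinearMap.id x) =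
      toTripleRight (leftMulBy fun a => l.t (op a)) (leftMulBy l.s) _ _
        (TensorProduct.map LinearMap.id r.comul y)
  -- `(Δ_r ⊗_A H) ∘ Δ_l = (H ⊗_B Δ_l) ∘ Δ_r` in `H ⊗_B H ⊗_A H`
  coassoc_rl : ∀ h x y, Submodule.mkQ _ x = r.comul h → Submodule.mkQ _ y = l.comul h →
    toTripleLeft _ _ (leftMulBy fun a => l.t (op a)) (leftMulBy l.s)
        (TensorProduct.map r.comul LinearMap.id y) =
      toTripleRight (rightMulBy r.s) (rightMulBy fun b => r.t (op b)) _ _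
        (TensorProduct.map LinearMap.id l.comul x)
  S_bimod : ∀ a b h, S (l.t (op a) * h * r.t (op b)) = r.s b * S h * l.s a
  -- `S(h₁) h₂ = s_r(ε_r(h))` for `Δ_l`, and `h₁ S(h₂) = s_l(ε_l(h))` for `Δ_r`
  antipode_left : ∀ h x, Submodule.mkQ _ x = l.comul h →
    LinearMap.mul' 𝕜 H (TensorProduct.map S LinearMap.id x) = r.s (r.counit h)
  antipode_right : ∀ h x, Submodule.mkQ _ x = r.comul h →
    LinearMap.mul' 𝕜 H (TensorProduct.map LinearMap.id S x) = l.s (l.counit h)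

variable {𝕜 A H} in
/-- The map `h ⊗ g ↦ f(h) ▷ g = s(f(h)) * g`. -/
def LeftBialgebroid.actBy (L : LeftBialgebroid 𝕜 A H) (f : H →ₗ[𝕜] A) : H ⊗[𝕜] H →ₗ[𝕜] H :=
  LinearMap.mul' 𝕜 H ∘ₗ TensorProduct.map (L.s.toLinearMap ∘ₗ f) LinearMap.id

end Bialgebroids

/-! ### Local biretractions -/

section Biretractions

variable {𝕜 A H : Type*} [Field 𝕜] [CommRing A] [Algebra 𝕜 A] [Ring H] [Algebra 𝕜 H]

/-- A local biretraction of a Hopf algebroid over a commutative algebra `A` (with both base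
algebras equal to `A`), relative to `s = s_r` and `t = t_r`. -/
structure Biretraction (𝓗 : HopfAlgebroid 𝕜 A A H) where
  /-- The underlying linear multiplicative (not necessarily unital) map. -/
  toHom : H →ₙₐ[𝕜] A
  brt1 : ∀ a, toHom (𝓗.r.s a) = a * toHom 1
  brt2 : ∃ e : A, toHom (𝓗.r.t (op e)) = toHom 1 ∧
    Set.BijOn (fun a => toHom (𝓗.r.t (op a))) (Ideal.span {e} : Ideal A)
      (Ideal.span {toHom 1} : Ideal A)

namespace Biretraction

variable {𝓗 : HopfAlgebroid 𝕜 A A H}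

/-- The underlying linear map of a biretraction. -/
def lin (α : Biretraction 𝓗) : H →ₗ[𝕜] A := (α.toHom : H →ₗ[𝕜] A)

/-- The element `e^α` of the base algebra. -/
def idem (α : Biretraction 𝓗) : A := α.brt2.choose

/-- The inverse `(α ∘ t)⁻¹ : A α(1) → A e^α` of the bijection `α ∘ t : A e^α → A α(1)`
(only its values on `A α(1)` are meaningful). -/
def tInv (α : Biretraction 𝓗) : A → A :=
  Function.invFunOn (fun a => α.lin (𝓗.r.t (op a))) (Ideal.span {α.idem} : Ideal A)

end Biretraction

end Biretractions

/-! ### Quantum inverse semigroups -/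

section QISG

variable {𝕜 Q : Type*} [Field 𝕜] [NonUnitalRing Q] [Module 𝕜 Q] [IsScalarTower 𝕜 Q Q]
  [SMulCommClass 𝕜 Q Q]

/-- The convolution product of endomorphisms, `f ∗ g = μ ∘ (f ⊗ g) ∘ Δ`. -/
def convEnd (Δ : Q →ₗ[𝕜] Q ⊗[𝕜] Q) (f g : Q →ₗ[𝕜] Q) : Q →ₗ[𝕜] Q :=
  LinearMap.mul' 𝕜 Q ∘ₗ TensorProduct.map f g ∘ₗ Δ

/-- The not necessarily unital `𝕜`-algebra `Q` with comultiplication `Δ` and pseudo-antipode `S`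
is a quantum inverse semigroup. -/
structure IsQuantumInverseSemigroup (Δ : Q →ₗ[𝕜] Q ⊗[𝕜] Q) (S : Q →ₗ[𝕜] Q) : Prop where
  comul_mul : ∀ x y, Δ (x * y) = Δ x * Δ y
  coassoc : (TensorProduct.assoc 𝕜 Q Q Q).toLinearMap ∘ₗ TensorProduct.map Δ LinearMap.id ∘ₗ Δ =
    TensorProduct.map LinearMap.id Δ ∘ₗ Δ
  antipode_mul : ∀ x y, S (x * y) = S y * S x
  conv_id_S_id : convEnd Δ (convEnd Δ LinearMap.id S) LinearMap.id = LinearMap.id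
  conv_S_id_S : convEnd Δ (convEnd Δ S LinearMap.id) S = S
  -- `x₁ S(x₂) S(y₁) y₂ = S(y₁) y₂ x₁ S(x₂)`
  comm : ∀ x y, convEnd Δ LinearMap.id S x * convEnd Δ S LinearMap.id y =
    convEnd Δ S LinearMap.id y * convEnd Δ LinearMap.id S x

end QISG

section SemigroupAlgebra

variable (𝕜 : Type*) {G V : Type*} [Field 𝕜] [AddCommGroup V] [Module 𝕜 V]

/-- The linear extension to `𝕜G` of a map defined on the basis `G`. -/
def linExt (f : G → V) : MonoidAlgebra 𝕜 G →ₗ[𝕜] V :=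
  Finsupp.linearCombination 𝕜 f ∘ₗ (MonoidAlgebra.coeffLinearEquiv 𝕜).toLinearMap

/-- The comultiplication of `𝕜G` for which the elements of `G` are group-like,
`Δ(g) = g ⊗ g`. -/
def groupLikeComul (G : Type*) :
    MonoidAlgebra 𝕜 G →ₗ[𝕜] MonoidAlgebra 𝕜 G ⊗[𝕜] MonoidAlgebra 𝕜 G :=
  linExt 𝕜 fun g => MonoidAlgebra.single g 1 ⊗ₜ[𝕜] MonoidAlgebra.single g 1

/-- The linear extension to `𝕜G` of a self-map of `G`. -/
def starExt (star : G → G) : MonoidAlgebra 𝕜 G →ₗ[𝕜] MonoidAlgebra 𝕜 G :=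
  linExt 𝕜 fun g => MonoidAlgebra.single (star g) 1

end SemigroupAlgebra

end

/-! Write t for `𝓗.l.s`, s for `𝓗.r.s`, τ for α ∘ t and σ for α ∘ S. The argument works with
functionals H → A: as A is commutative, f(h₁)g(h₂) makes sense once f and g are balanced, and
coassociativity, mixed or not, becomes associativity of such convolutions.

The antipode axioms make σ a convolution inverse of α: σ(h₁)α(h₂) = α(1)ε_r(h) and α(h¹)σ(h²) =
τ(ε_l(h)). Hence α can be cancelled (`eq_zero_of_pairing_lin_right`, `eq_zero_of_pairing_lin_left`).
Cancellation replaces the fact that S reverses products: σ(hg) and σ(h)σ(g) agree after convolving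
with α in each variable, so σ is multiplicative (`sigma_mul`). Likewise the counits, once multiplied
by α(1), are multiplicative and related by S. So h ↦ α(S(ε_l(h¹) ▷ h²)) is multiplicative, and
following it by the inverse of τ gives α*.

On the base algebra, αβ induces τ_β ∘ τ_α: biretractions compose like partial bijections between
ideals generated by idempotents, and α* induces the inverse. Mixed coassociativity gives αα* = e^α
ε_l and α*α = α(1)ε_l (`lin_mul_star`, `lin_star_mul`). Biretractions that are multiples of ε_l form
a commutative subsemigroup and act on the left by scaling, so αα*α = α and α*αα* = α*. Every
idempotent lies in that subsemigroup, so idempotents commute, generalized inverses are unique, and α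
↦ α* reverses products. The quantum inverse semigroup axioms then reduce, by linearity, to
identities between basis elements. -/

noncomputable section

/-! ### Pairings of linear functionals with balanced tensors -/

section Pairing

variable {𝕜 R M N P ι κ H : Type*} [Field 𝕜] [CommRing R] [Algebra 𝕜 R]
  [AddCommGroup M] [Module 𝕜 M] [AddCommGroup N] [Module 𝕜 N] [AddCommGroup P] [Module 𝕜 P]
  [AddCommGroup H] [Module 𝕜 H]

/-- The functional `m ⊗ n ↦ f m * g n`. -/
def pairing (f : M →ₗ[𝕜] R) (g : N →ₗ[𝕜] R) : M ⊗[𝕜] N →ₗ[𝕜] R :=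
  LinearMap.mul' 𝕜 R ∘ₗ TensorProduct.map f g

@[simp]
theorem pairing_tmul (f : M →ₗ[𝕜] R) (g : N →ₗ[𝕜] R) (m : M) (n : N) :
    pairing f g (m ⊗ₜ n) = f m * g n := rfl

/-- The functionals `f` and `g` satisfy `f (m ◁ a) * g n = f m * g (a ▷ n)`. -/
def Balances (ρ : ι → M →ₗ[𝕜] M) (l : ι → N →ₗ[𝕜] N) (f : M →ₗ[𝕜] R) (g : N →ₗ[𝕜] R) : Prop :=
  ∀ a m n, f (ρ a m) * g n = f m * g (l a n)

variable {ρ : ι → M →ₗ[𝕜] M} {l : ι → N →ₗ[𝕜] N} {ρ' : κ → N →ₗ[𝕜] N} {l' : κ → P →ₗ[𝕜] P}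
  {f : M →ₗ[𝕜] R} {g : N →ₗ[𝕜] R} {k : P →ₗ[𝕜] R}

theorem Balances.le_ker (hb : Balances ρ l f g) :
    balancedRel ρ l ≤ LinearMap.ker (pairing f g) := by
  refine Submodule.span_le.2 ?_
  rintro _ ⟨a, m, n, rfl⟩
  simp [hb a m n]

/-- The functional induced on `M ⊗_A N` by a balanced pair of functionals. -/
def Balances.lift (hb : Balances ρ l f g) : BalancedTensor ρ l →ₗ[𝕜] R :=
  (balancedRel ρ l).liftQ (pairing f g) hb.le_ker

@[simp]
theorem Balances.lift_mkQ (hb : Balances ρ l f g) (x : M ⊗[𝕜] N) :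
    hb.lift (Submodule.mkQ _ x) = pairing f g x := rfl

theorem Balances.lift_of_mkQ_eq (hb : Balances ρ l f g) {x : M ⊗[𝕜] N} {z : BalancedTensor ρ l}
    (hx : Submodule.mkQ _ x = z) : hb.lift z = pairing f g x := by
  rw [← hx, hb.lift_mkQ]

theorem Balances.pairing_congr (hb : Balances ρ l f g) {x y : M ⊗[𝕜] N}
    (h : Submodule.mkQ (balancedRel ρ l) x = Submodule.mkQ _ y) :
    pairing f g x = pairing f g y := by
  rw [← hb.lift_mkQ, h, hb.lift_mkQ]

theorem Balances.le_ker₃ (hb : Balances ρ l f g) (hb' : Balances ρ' l' g k) :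
    balancedRel₃ ρ l ρ' l' ≤ LinearMap.ker (pairing f (pairing g k)) := by
  refine Submodule.span_le.2 ?_
  rintro _ (⟨a, m, n, p, rfl⟩ | ⟨a, m, n, p, rfl⟩)
  · simp [← mul_assoc, hb a m n]
  · simp [hb' a n p]

/-- The functional induced on `M ⊗_A N ⊗_B P` by three functionals with balanced neighbours. -/
def Balances.lift₃ (hb : Balances ρ l f g) (hb' : Balances ρ' l' g k) :
    BalancedTensor₃ ρ l ρ' l' →ₗ[𝕜] R :=
  (balancedRel₃ ρ l ρ' l').liftQ (pairing f (pairing g k)) (hb.le_ker₃ hb')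

theorem Balances.lift₃_toTripleLeft (hb : Balances ρ l f g) (hb' : Balances ρ' l' g k) :
    hb.lift₃ hb' ∘ₗ toTripleLeft ρ l ρ' l' = pairing hb.lift k := by
  refine TensorProduct.ext' fun z p => ?_
  obtain ⟨x, rfl⟩ := Submodule.mkQ_surjective _ z
  induction x with
  | zero => simp
  | add x y hx hy => simp only [map_add, TensorProduct.add_tmul, hx, hy]
  | tmul m n => exact (mul_assoc (f m) (g n) (k p)).symm

theorem Balances.lift₃_toTripleRight (hb : Balances ρ l f g) (hb' : Balances ρ' l' g k) :
    hb.lift₃ hb' ∘ₗ toTripleRight ρ l ρ' l' = pairing f hb'.lift := by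
  refine TensorProduct.ext' fun m z => ?_
  obtain ⟨x, rfl⟩ := Submodule.mkQ_surjective _ z
  induction x with
  | zero => simp
  | add x y hx hy => simp only [map_add, TensorProduct.tmul_add, hx, hy]
  | tmul n p => rfl

theorem pairing_map {M' N' : Type*} [AddCommGroup M'] [Module 𝕜 M'] [AddCommGroup N'] [Module 𝕜 N']
    (f : M →ₗ[𝕜] R) (g : N →ₗ[𝕜] R) (φ : M' →ₗ[𝕜] M) (ψ : N' →ₗ[𝕜] N) (x : M' ⊗[𝕜] N') :
    pairing f g (TensorProduct.map φ ψ x) = pairing (f ∘ₗ φ) (g ∘ₗ ψ) x := by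
  induction x with
  | zero => simp
  | add x y hx hy => simp only [map_add, hx, hy]
  | tmul m n => rfl

/-- Coassociativity, evaluated on three functionals with balanced neighbours. -/
theorem Balances.pairing_eq_of_coassoc {f' : H →ₗ[𝕜] R} {k' : H →ₗ[𝕜] R}
    (hb : Balances ρ l f g) (hb' : Balances ρ' l' g k)
    {D : H →ₗ[𝕜] BalancedTensor ρ l} {D' : H →ₗ[𝕜] BalancedTensor ρ' l'}
    (hf' : ∀ h x, Submodule.mkQ _ x = D h → f' h = pairing f g x)
    (hk' : ∀ h x, Submodule.mkQ _ x = D' h → k' h = pairing g k x)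
    {x : H ⊗[𝕜] P} {y : M ⊗[𝕜] H}
    (hxy : toTripleLeft ρ l ρ' l' (TensorProduct.map D LinearMap.id x) =
      toTripleRight ρ l ρ' l' (TensorProduct.map LinearMap.id D' y)) :
    pairing f' k x = pairing f k' y := by
  -- A functional prescribed on all representatives factors through the comultiplication; both sides
  -- are then values of one functional on the triple tensor product.
  have h1 : f' = hb.lift ∘ₗ D := by
    ext h
    obtain ⟨z, hz⟩ := Submodule.mkQ_surjective _ (D h)
    rw [hf' h z hz, LinearMap.comp_apply, hb.lift_of_mkQ_eq hz]
  have h2 : k' = hb'.lift ∘ₗ D' := by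
    ext h
    obtain ⟨z, hz⟩ := Submodule.mkQ_surjective _ (D' h)
    rw [hk' h z hz, LinearMap.comp_apply, hb'.lift_of_mkQ_eq hz]
  have h3 := congrArg (hb.lift₃ hb') hxy
  rw [← LinearMap.comp_apply, ← LinearMap.comp_apply (hb.lift₃ hb'), hb.lift₃_toTripleLeft hb',
    hb.lift₃_toTripleRight hb', pairing_map, pairing_map] at h3
  rw [h1, h2]
  exact h3

theorem pairing_zero_left (g : N →ₗ[𝕜] R) : pairing (0 : M →ₗ[𝕜] R) g = 0 := by
  ext; simp

theorem pairing_zero_right (f : M →ₗ[𝕜] R) : pairing f (0 : N →ₗ[𝕜] R) = 0 := by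
  ext; simp

theorem pairing_sub_left (f f' : M →ₗ[𝕜] R) (g : N →ₗ[𝕜] R) :
    pairing (f - f') g = pairing f g - pairing f' g := by
  ext; simp [sub_mul]

theorem pairing_sub_right (f : M →ₗ[𝕜] R) (g g' : N →ₗ[𝕜] R) :
    pairing f (g - g') = pairing f g - pairing f g' := by
  ext; simp [mul_sub]

theorem pairing_smul_left (a : R) (f : M →ₗ[𝕜] R) (g : N →ₗ[𝕜] R) :
    pairing (a • f) g = a • pairing f g := by
  ext; simp [mul_assoc]

theorem pairing_smul_right (a : R) (f : M →ₗ[𝕜] R) (g : N →ₗ[𝕜] R) :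
    pairing f (a • g) = a • pairing f g := by
  ext; simp [mul_left_comm]

theorem pairing_comp (φ : R →ₗ[𝕜] R) (hφ : ∀ a b, φ (a * b) = φ a * φ b) (f : M →ₗ[𝕜] R)
    (g : N →ₗ[𝕜] R) : pairing (φ ∘ₗ f) (φ ∘ₗ g) = φ ∘ₗ pairing f g := by
  ext; simp [hφ]

theorem pairing_mul {B C : Type*} [Ring B] [Algebra 𝕜 B] [Ring C] [Algebra 𝕜 C]
    {f : B →ₗ[𝕜] R} {g : C →ₗ[𝕜] R} (hf : ∀ a b, f (a * b) = f a * f b)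
    (hg : ∀ a b, g (a * b) = g a * g b) (x y : B ⊗[𝕜] C) :
    pairing f g (x * y) = pairing f g x * pairing f g y := by
  induction x with
  | zero => simp
  | add x x' hx hx' => simp only [add_mul, map_add, hx, hx']
  | tmul m n =>
    induction y with
    | zero => simp
    | add y y' hy hy' => simp only [mul_add, map_add, hy, hy']
    | tmul m' n' => simp [hf, hg, mul_mul_mul_comm]

end Pairing

/-! ### Hopf algebroids with flipped source and target maps -/

namespace HopfAlgebroid

section Flipped

variable {𝕜 A H : Type*} [Field 𝕜] [CommRing A] [Algebra 𝕜 A] [Ring H] [Algebra 𝕜 H]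

/-- The source and target maps of the two bialgebroids are interchanged:
`s_l = t_r` and `s_r = t_l`. -/
class IsFlipped (𝓗 : HopfAlgebroid 𝕜 A A H) : Prop where
  r_t : ∀ a : A, 𝓗.r.t (op a) = 𝓗.l.s a
  l_t : ∀ a : A, 𝓗.l.t (op a) = 𝓗.r.s a

variable (𝓗 : HopfAlgebroid 𝕜 A A H)

/-- `x` represents `Δ_l(h)`. -/
def IsLeftRep (h : H) (x : H ⊗[𝕜] H) : Prop := Submodule.mkQ _ x = 𝓗.l.comul h

/-- `x` represents `Δ_r(h)`. -/
def IsRightRep (h : H) (x : H ⊗[𝕜] H) : Prop := Submodule.mkQ _ x = 𝓗.r.comul h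

/-- The pair `f`, `g` is balanced for the tensor product of the left bialgebroid. -/
def LeftBalanced (f g : H →ₗ[𝕜] A) : Prop :=
  ∀ a h k, f (𝓗.r.s a * h) * g k = f h * g (𝓗.l.s a * k)

/-- The pair `f`, `g` is balanced for the tensor product of the right bialgebroid. -/
def RightBalanced (f g : H →ₗ[𝕜] A) : Prop :=
  ∀ a h k, f (h * 𝓗.r.s a) * g k = f h * g (k * 𝓗.l.s a)

variable {𝓗}

theorem exists_isLeftRep (h : H) : ∃ x, 𝓗.IsLeftRep h x := Submodule.mkQ_surjective _ _

theorem exists_isRightRep (h : H) : ∃ x, 𝓗.IsRightRep h x := Submodule.mkQ_surjective _ _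

/-- The axioms do not include ε_l(1) = 1. The counit law at 1 gives it only after applying t; later
it is recovered after multiplication by α(1). -/
theorem s_l_counit_one : 𝓗.l.s (𝓗.l.counit 1) = 1 := by
  simpa using 𝓗.l.counit_left 1 (1 ⊗ₜ 1) 𝓗.l.comul_one.symm

theorem s_r_counit_one : 𝓗.r.s (𝓗.r.counit 1) = 1 := by
  simpa using 𝓗.r.counit_right 1 (1 ⊗ₜ 1) 𝓗.r.comul_one.symm

theorem S_one : 𝓗.S 1 = 1 := by
  have := 𝓗.antipode_left 1 (1 ⊗ₜ 1) 𝓗.l.comul_one.symm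
  simpa [s_r_counit_one] using this

theorem isLeftRep_one : 𝓗.IsLeftRep 1 (1 ⊗ₜ 1) := 𝓗.l.comul_one.symm

theorem isRightRep_one : 𝓗.IsRightRep 1 (1 ⊗ₜ 1) := 𝓗.r.comul_one.symm

theorem IsLeftRep.mul {h g : H} {x y : H ⊗[𝕜] H} (hx : 𝓗.IsLeftRep h x)
    (hy : 𝓗.IsLeftRep g y) : 𝓗.IsLeftRep (h * g) (x * y) := (𝓗.l.comul_mul h g x y hx hy).symm

theorem IsRightRep.mul {h g : H} {x y : H ⊗[𝕜] H} (hx : 𝓗.IsRightRep h x)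
    (hy : 𝓗.IsRightRep g y) : 𝓗.IsRightRep (h * g) (x * y) := (𝓗.r.comul_mul h g x y hx hy).symm

theorem isLeftRep_s_l (a : A) : 𝓗.IsLeftRep (𝓗.l.s a) (𝓗.l.s a ⊗ₜ 1) := by
  have := 𝓗.l.comul_bimod a 1 1 _ isLeftRep_one
  simpa [IsLeftRep] using this.symm

theorem isRightRep_s_r (a : A) : 𝓗.IsRightRep (𝓗.r.s a) (1 ⊗ₜ 𝓗.r.s a) := by
  have := 𝓗.r.comul_bimod 1 a 1 _ isRightRep_one
  simpa [IsRightRep, IsFlipped.r_t] using this.symm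

theorem l_counit_s_l_mul (a : A) (h : H) : 𝓗.l.counit (𝓗.l.s a * h) = a * 𝓗.l.counit h := by
  simpa using 𝓗.l.counit_bimod a 1 h

theorem r_counit_mul_s_r (a : A) (h : H) : 𝓗.r.counit (h * 𝓗.r.s a) = a * 𝓗.r.counit h := by
  simpa [mul_comm] using 𝓗.r.counit_bimod 1 a h

/-- `F(ε_l(h₁) ▷ h₂) = F(h)`. -/
theorem pairing_counit_left_l {F : H →ₗ[𝕜] A} {φ : A →ₗ[𝕜] A} {h : H} {x : H ⊗[𝕜] H}
    (hF : ∀ a h, F (𝓗.l.s a * h) = φ a * F h)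
    (hx : 𝓗.IsLeftRep h x) : pairing (φ ∘ₗ 𝓗.l.counit) F x = F h := by
  rw [← 𝓗.l.counit_left h x hx]
  clear hx
  induction x with
  | zero => simp
  | add x y hx hy => simp only [map_add, hx, hy]
  | tmul m n => simp [hF]

/-- `F(h¹ ◀ ε_r(h²)) = F(h)`. -/
theorem pairing_counit_right_r {F : H →ₗ[𝕜] A} {φ : A →ₗ[𝕜] A} {h : H} {x : H ⊗[𝕜] H}
    (hF : ∀ a h, F (h * 𝓗.r.s a) = φ a * F h)
    (hx : 𝓗.IsRightRep h x) : pairing F (φ ∘ₗ 𝓗.r.counit) x = F h := by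
  rw [← 𝓗.r.counit_right h x hx]
  clear hx
  induction x with
  | zero => simp
  | add x y hx hy => simp only [map_add, hx, hy]
  | tmul m n => simp [hF, mul_comm]

variable [𝓗.IsFlipped]

theorem LeftBalanced.balances {f g : H →ₗ[𝕜] A} (hb : 𝓗.LeftBalanced f g) :
    Balances (leftMulBy fun a => 𝓗.l.t (op a)) (leftMulBy 𝓗.l.s) f g := by
  intro a h k
  simpa [leftMulBy, IsFlipped.l_t] using hb a h k

theorem RightBalanced.balances {f g : H →ₗ[𝕜] A} (hb : 𝓗.RightBalanced f g) :
    Balances (rightMulBy 𝓗.r.s) (rightMulBy fun a => 𝓗.r.t (op a)) f g := by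
  intro a h k
  simpa [rightMulBy, IsFlipped.r_t] using hb a h k

/-- `h ↦ f(h₁) g(h₂)` for the left comultiplication. -/
def LeftBalanced.conv {f g : H →ₗ[𝕜] A} (hb : 𝓗.LeftBalanced f g) : H →ₗ[𝕜] A :=
  hb.balances.lift ∘ₗ 𝓗.l.comul

/-- `h ↦ f(h¹) g(h²)` for the right comultiplication. -/
def RightBalanced.conv {f g : H →ₗ[𝕜] A} (hb : 𝓗.RightBalanced f g) : H →ₗ[𝕜] A :=
  hb.balances.lift ∘ₗ 𝓗.r.comul

theorem LeftBalanced.conv_eq {f g : H →ₗ[𝕜] A} (hb : 𝓗.LeftBalanced f g) {h : H}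
    {x : H ⊗[𝕜] H} (hx : 𝓗.IsLeftRep h x) : hb.conv h = pairing f g x :=
  hb.balances.lift_of_mkQ_eq hx

theorem RightBalanced.conv_eq {f g : H →ₗ[𝕜] A} (hb : 𝓗.RightBalanced f g) {h : H}
    {x : H ⊗[𝕜] H} (hx : 𝓗.IsRightRep h x) : hb.conv h = pairing f g x :=
  hb.balances.lift_of_mkQ_eq hx

theorem isLeftRep_s_r (a : A) : 𝓗.IsLeftRep (𝓗.r.s a) (1 ⊗ₜ 𝓗.r.s a) := by
  have := 𝓗.l.comul_bimod 1 a 1 _ isLeftRep_one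
  simpa [IsLeftRep, IsFlipped.l_t] using this.symm

theorem isRightRep_s_l (a : A) : 𝓗.IsRightRep (𝓗.l.s a) (𝓗.l.s a ⊗ₜ 1) := by
  have := 𝓗.r.comul_bimod a 1 1 _ isRightRep_one
  simpa [IsRightRep, IsFlipped.r_t] using this.symm

theorem l_counit_s_r_mul (a : A) (h : H) : 𝓗.l.counit (𝓗.r.s a * h) = a * 𝓗.l.counit h := by
  simpa [IsFlipped.l_t, mul_comm] using 𝓗.l.counit_bimod 1 a h

theorem r_counit_mul (h g : H) : 𝓗.r.counit (h * g) = 𝓗.r.counit (𝓗.l.s (𝓗.r.counit h) * g) := by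
  simpa [IsFlipped.r_t] using 𝓗.r.counit_mul_t h g

theorem S_s_r_mul (a : A) (h : H) : 𝓗.S (𝓗.r.s a * h) = 𝓗.S h * 𝓗.l.s a := by
  simpa [IsFlipped.l_t] using 𝓗.S_bimod a 1 h

theorem S_mul_s_l (a : A) (h : H) : 𝓗.S (h * 𝓗.l.s a) = 𝓗.r.s a * 𝓗.S h := by
  simpa [IsFlipped.r_t] using 𝓗.S_bimod 1 a h

section Functionals

variable {F f g k : H →ₗ[𝕜] A} {φ : A →ₗ[𝕜] A} {h : H} {x y : H ⊗[𝕜] H}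

/-- `F(h₁ ◁ ε_l(h₂)) = F(h)`. -/
theorem pairing_counit_right_l (hF : ∀ a h, F (𝓗.r.s a * h) = φ a * F h)
    (hx : 𝓗.IsLeftRep h x) : pairing F (φ ∘ₗ 𝓗.l.counit) x = F h := by
  rw [← 𝓗.l.counit_right h x hx]
  clear hx
  induction x with
  | zero => simp
  | add x y hx hy => simp only [map_add, hx, hy]
  | tmul m n => simp [hF, IsFlipped.l_t, mul_comm]

/-- `F(ε_r(h¹) ▶ h²) = F(h)`. -/
theorem pairing_counit_left_r (hF : ∀ a h, F (h * 𝓗.l.s a) = φ a * F h)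
    (hx : 𝓗.IsRightRep h x) : pairing (φ ∘ₗ 𝓗.r.counit) F x = F h := by
  rw [← 𝓗.r.counit_left h x hx]
  clear hx
  induction x with
  | zero => simp
  | add x y hx hy => simp only [map_add, hx, hy]
  | tmul m n => simp [hF, IsFlipped.r_t]

theorem LeftBalanced.pairing_takeuchi (hb : 𝓗.LeftBalanced f g) (hx : 𝓗.IsLeftRep h x) (a : A) :
    pairing f g (x * (𝓗.r.s a ⊗ₜ 1)) = pairing f g (x * (1 ⊗ₜ 𝓗.l.s a)) := by
  have := hb.balances.pairing_congr (𝓗.l.comul_takeuchi a h x hx)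
  rwa [IsFlipped.l_t] at this

theorem RightBalanced.pairing_takeuchi (hb : 𝓗.RightBalanced f g) (hx : 𝓗.IsRightRep h x)
    (a : A) : pairing f g ((𝓗.r.s a ⊗ₜ 1) * x) = pairing f g ((1 ⊗ₜ 𝓗.l.s a) * x) := by
  have := hb.balances.pairing_congr (𝓗.r.comul_takeuchi a h x hx)
  rwa [IsFlipped.r_t] at this

variable {f' k' : H →ₗ[𝕜] A}

theorem pairing_coassoc_l (hb : 𝓗.LeftBalanced f g) (hb' : 𝓗.LeftBalanced g k)
    (hf' : ∀ h x, 𝓗.IsLeftRep h x → f' h = pairing f g x)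
    (hk' : ∀ h x, 𝓗.IsLeftRep h x → k' h = pairing g k x)
    (hx : 𝓗.IsLeftRep h x) (hy : 𝓗.IsLeftRep h y) : pairing f' k x = pairing f k' y :=
  hb.balances.pairing_eq_of_coassoc hb'.balances hf' hk' (𝓗.l.coassoc h x y hx hy)

theorem pairing_coassoc_lr (hb : 𝓗.LeftBalanced f g) (hb' : 𝓗.RightBalanced g k)
    (hf' : ∀ h x, 𝓗.IsLeftRep h x → f' h = pairing f g x)
    (hk' : ∀ h x, 𝓗.IsRightRep h x → k' h = pairing g k x)
    (hx : 𝓗.IsRightRep h x) (hy : 𝓗.IsLeftRep h y) : pairing f' k x = pairing f k' y :=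
  hb.balances.pairing_eq_of_coassoc hb'.balances hf' hk' (𝓗.coassoc_lr h x y hx hy)

theorem pairing_coassoc_rl (hb : 𝓗.RightBalanced f g) (hb' : 𝓗.LeftBalanced g k)
    (hf' : ∀ h x, 𝓗.IsRightRep h x → f' h = pairing f g x)
    (hk' : ∀ h x, 𝓗.IsLeftRep h x → k' h = pairing g k x)
    (hx : 𝓗.IsLeftRep h x) (hy : 𝓗.IsRightRep h y) : pairing f' k x = pairing f k' y :=
  hb.balances.pairing_eq_of_coassoc hb'.balances hf' hk' (𝓗.coassoc_rl h y x hy hx)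

end Functionals

end Flipped

end HopfAlgebroid

/-! ### Local biretractions: the antipode -/

namespace Biretraction

open HopfAlgebroid

variable {𝕜 A H : Type*} [Field 𝕜] [CommRing A] [Algebra 𝕜 A] [Ring H] [Algebra 𝕜 H]
  {𝓗 : HopfAlgebroid 𝕜 A A H}

theorem ext_lin {α β : Biretraction 𝓗} (h : ∀ x, α.lin x = β.lin x) : α = β := by
  cases α
  cases β
  congr 1
  exact NonUnitalAlgHom.ext h

variable (α : Biretraction 𝓗)

theorem lin_mul (h g : H) : α.lin (h * g) = α.lin h * α.lin g := map_mul α.toHom h g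

theorem lin_one_mul (h : H) : α.lin 1 * α.lin h = α.lin h := by
  rw [← lin_mul, one_mul]

theorem lin_s (a : A) : α.lin (𝓗.r.s a) = a * α.lin 1 := α.brt1 a

theorem lin_s_mul (a : A) (h : H) : α.lin (𝓗.r.s a * h) = a * α.lin h := by
  rw [lin_mul, lin_s, mul_assoc, lin_one_mul]

theorem lin_mul_s (a : A) (h : H) : α.lin (h * 𝓗.r.s a) = a * α.lin h := by
  rw [lin_mul, mul_comm, ← lin_mul, lin_s_mul]

/-- The map `α ∘ t`. -/
def tau : A →ₗ[𝕜] A := α.lin ∘ₗ 𝓗.l.s.toLinearMap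

theorem tau_apply (a : A) : α.tau a = α.lin (𝓗.l.s a) := rfl

theorem tau_mul (a b : A) : α.tau (a * b) = α.tau a * α.tau b := by
  simp [tau_apply, lin_mul]

theorem lin_one_mul_tau (a : A) : α.lin 1 * α.tau a = α.tau a := α.lin_one_mul _

theorem lin_t_mul (a : A) (h : H) : α.lin (𝓗.l.s a * h) = α.tau a * α.lin h := α.lin_mul _ _

theorem lin_mul_t (a : A) (h : H) : α.lin (h * 𝓗.l.s a) = α.tau a * α.lin h := by
  rw [lin_mul, mul_comm, tau_apply]

/-- The functional `α ∘ S`. -/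
def sigma : H →ₗ[𝕜] A := α.lin ∘ₗ 𝓗.S

theorem sigma_apply (h : H) : α.sigma h = α.lin (𝓗.S h) := rfl

theorem lin_one_mul_sigma (h : H) : α.lin 1 * α.sigma h = α.sigma h := α.lin_one_mul _

theorem sigma_one : α.sigma 1 = α.lin 1 := by rw [sigma_apply, S_one]

/-- The antipode axiom for Δ_l, transported by the multiplicative map α: one half of the statement
that σ inverts α. -/
theorem pairing_sigma_lin {h : H} {x : H ⊗[𝕜] H} (hx : 𝓗.IsLeftRep h x) :
    pairing α.sigma α.lin x = α.lin 1 * 𝓗.r.counit h := by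
  rw [mul_comm, ← lin_s, ← 𝓗.antipode_left h x hx]
  clear hx
  induction x with
  | zero => simp
  | add x y hx hy => simp only [map_add, hx, hy]
  | tmul m n => simp [lin_mul, sigma_apply]

theorem pairing_lin_sigma {h : H} {x : H ⊗[𝕜] H} (hx : 𝓗.IsRightRep h x) :
    pairing α.lin α.sigma x = α.tau (𝓗.l.counit h) := by
  rw [tau_apply, ← 𝓗.antipode_right h x hx]
  clear hx
  induction x with
  | zero => simp
  | add x y hx hy => simp only [map_add, hx, hy]
  | tmul m n => simp [lin_mul, sigma_apply]

theorem lin_one_mul_r_counit_one : α.lin 1 * 𝓗.r.counit 1 = α.lin 1 := by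
  rw [mul_comm, ← lin_s, s_r_counit_one]

theorem leftBalanced_lin_of {F : H →ₗ[𝕜] A} (hF : ∀ a h, F (𝓗.r.s a * h) = α.tau a * F h) :
    𝓗.LeftBalanced F α.lin := fun a h k => by
  rw [hF, lin_t_mul]; ring

theorem rightBalanced_lin_of {F : H →ₗ[𝕜] A} (hF : ∀ a h, F (h * 𝓗.l.s a) = a * F h) :
    𝓗.RightBalanced α.lin F := fun a h k => by
  rw [lin_mul_s, hF]; ring

/-- The functional `α(1) ε_l`. -/
def counitOn : H →ₗ[𝕜] A := α.lin 1 • 𝓗.l.counit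

theorem counitOn_apply (h : H) : α.counitOn h = α.lin 1 * 𝓗.l.counit h := rfl

variable [𝓗.IsFlipped]

theorem sigma_s_mul (a : A) (h : H) : α.sigma (𝓗.r.s a * h) = α.tau a * α.sigma h := by
  rw [sigma_apply, S_s_r_mul, lin_mul_t, sigma_apply]

theorem sigma_mul_t (a : A) (h : H) : α.sigma (h * 𝓗.l.s a) = a * α.sigma h := by
  rw [sigma_apply, S_mul_s_l, lin_s_mul, sigma_apply]

theorem rightBalanced_lin_sigma : 𝓗.RightBalanced α.lin α.sigma := fun a h k => by
  rw [lin_mul_s, sigma_mul_t]; ring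

/-- A functional vanishes if its right convolution with `α` does. -/
theorem eq_zero_of_pairing_lin_right {F : H →ₗ[𝕜] A}
    (hF : ∀ a h, F (𝓗.r.s a * h) = α.tau a * F h)
    (h0 : ∀ h x, 𝓗.IsLeftRep h x → pairing F α.lin x = 0) (h : H) : F h = 0 := by
  obtain ⟨x, hx⟩ := exists_isRightRep (𝓗 := 𝓗) h
  obtain ⟨y, hy⟩ := exists_isLeftRep (𝓗 := 𝓗) h
  -- F(h) = F(h₁)τ(ε_l(h₂)), and τ ∘ ε_l is the right convolution of α and σ. Mixed coassociativity
  -- moves the bracket onto F and α, whose convolution is zero.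
  rw [← pairing_counit_right_l hF hy, ← pairing_coassoc_lr (f' := 0) (α.leftBalanced_lin_of hF)
    α.rightBalanced_lin_sigma (fun h x hx => (h0 h x hx).symm)
    (fun h x hx => (α.pairing_lin_sigma hx).symm) hx hy, pairing_zero_left,
    LinearMap.zero_apply]

theorem leftBalanced_sigma_lin : 𝓗.LeftBalanced α.sigma α.lin :=
  α.leftBalanced_lin_of α.sigma_s_mul

/-- A functional vanishes if its left convolution with `α` does. -/
theorem eq_zero_of_pairing_lin_left {F : H →ₗ[𝕜] A}
    (hF : ∀ a h, F (h * 𝓗.l.s a) = a * F h) (hF1 : ∀ h, α.lin 1 * F h = F h)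
    (h0 : ∀ h x, 𝓗.IsRightRep h x → pairing α.lin F x = 0) (h : H) : F h = 0 := by
  obtain ⟨x, hx⟩ := exists_isRightRep (𝓗 := 𝓗) h
  obtain ⟨y, hy⟩ := exists_isLeftRep (𝓗 := 𝓗) h
  -- Since F takes values in Aα(1), a may be replaced by α(1)a, so that the counit law involves
  -- α(1)ε_r, the left convolution of σ and α.
  have hF' : ∀ a h, F (h * 𝓗.l.s a) = LinearMap.mulLeft 𝕜 (α.lin 1) a * F h := fun a h => by
    rw [hF, LinearMap.mulLeft_apply, mul_right_comm, hF1, mul_comm]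
  rw [← pairing_counit_left_r hF' hx, pairing_coassoc_lr (k' := 0) α.leftBalanced_sigma_lin
    (α.rightBalanced_lin_of hF) (fun h x hx => (α.pairing_sigma_lin hx).symm)
    (fun h x hx => (h0 h x hx).symm) hx hy, pairing_zero_right, LinearMap.zero_apply]

/-! ### Multiplicativity of σ and of the counits multiplied by α(1) -/

theorem sigma_mul_t_mul (h : H) (a : A) (g : H) :
    α.sigma (h * 𝓗.l.s a * g) = a * α.sigma (h * g) := by
  refine sub_eq_zero.1 <| α.eq_zero_of_pairing_lin_left
    (F := α.sigma ∘ₗ LinearMap.mulLeft 𝕜 (h * 𝓗.l.s a) - a • (α.sigma ∘ₗ LinearMap.mulLeft 𝕜 h))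
    (fun b g => ?_) (fun g => ?_) (fun g x hx => ?_) g
  · simp only [LinearMap.sub_apply, LinearMap.smul_apply, LinearMap.comp_apply,
      LinearMap.mulLeft_apply, smul_eq_mul, ← mul_assoc _ g, sigma_mul_t]
    ring
  · simp only [LinearMap.sub_apply, LinearMap.smul_apply, LinearMap.comp_apply,
      LinearMap.mulLeft_apply, smul_eq_mul, mul_sub, mul_left_comm _ a, lin_one_mul_sigma]
  · have hb : 𝓗.RightBalanced α.lin (α.sigma ∘ₗ LinearMap.mulLeft 𝕜 h) :=
      α.rightBalanced_lin_of fun b g => by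
        simp only [LinearMap.comp_apply, LinearMap.mulLeft_apply, ← mul_assoc h, sigma_mul_t]
    -- The Takeuchi property moves the inner factor: α(g¹)σ(h t(a) g²) = α(s(a) g¹)σ(h g²), and α
    -- pulls out a.
    have key := hb.pairing_takeuchi hx a
    have h1 : pairing α.lin (α.sigma ∘ₗ LinearMap.mulLeft 𝕜 (h * 𝓗.l.s a)) x =
        pairing α.lin (α.sigma ∘ₗ LinearMap.mulLeft 𝕜 h) ((1 ⊗ₜ 𝓗.l.s a) * x) := by
      clear hx key
      induction x with
      | zero => simp
      | add x y hx hy => simp only [map_add, mul_add, hx, hy]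
      | tmul m n => simp
    have h2 : pairing α.lin (α.sigma ∘ₗ LinearMap.mulLeft 𝕜 h) ((𝓗.r.s a ⊗ₜ 1) * x) =
        a * pairing α.lin (α.sigma ∘ₗ LinearMap.mulLeft 𝕜 h) x := by
      clear hx key h1
      induction x with
      | zero => simp
      | add x y hx hy => simp only [map_add, mul_add, hx, hy]
      | tmul m n => simp [mul_assoc, lin_s_mul]
    rw [pairing_sub_right, pairing_smul_right, LinearMap.sub_apply, LinearMap.smul_apply, h1,
      ← key, h2, smul_eq_mul, sub_self]

theorem sigma_mul_s_mul (h : H) (a : A) (g : H) :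
    α.sigma (h * 𝓗.r.s a * g) = α.tau a * α.sigma (h * g) := by
  rw [mul_assoc]
  refine sub_eq_zero.1 <| α.eq_zero_of_pairing_lin_right
    (F := α.sigma ∘ₗ LinearMap.mulRight 𝕜 (𝓗.r.s a * g) -
      α.tau a • (α.sigma ∘ₗ LinearMap.mulRight 𝕜 g))
    (fun b h => ?_) (fun h x hx => ?_) h
  · simp only [LinearMap.sub_apply, LinearMap.smul_apply, LinearMap.comp_apply,
      LinearMap.mulRight_apply, smul_eq_mul, mul_assoc _ h, sigma_s_mul]
    ring
  · have hb : 𝓗.LeftBalanced (α.sigma ∘ₗ LinearMap.mulRight 𝕜 g) α.lin :=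
      α.leftBalanced_lin_of fun b h => by
        simp only [LinearMap.comp_apply, LinearMap.mulRight_apply, mul_assoc, sigma_s_mul]
    -- Here the Takeuchi property gives σ(h₁ s(a) g)α(h₂) = σ(h₁ g)α(h₂ t(a)), and α pulls out τ(a).
    have key := hb.pairing_takeuchi hx a
    have h1 : pairing (α.sigma ∘ₗ LinearMap.mulRight 𝕜 (𝓗.r.s a * g)) α.lin x =
        pairing (α.sigma ∘ₗ LinearMap.mulRight 𝕜 g) α.lin (x * (𝓗.r.s a ⊗ₜ 1)) := by
      clear hx key
      induction x with
      | zero => simp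
      | add x y hx hy => simp only [map_add, add_mul, hx, hy]
      | tmul m n => simp
    have h2 : pairing (α.sigma ∘ₗ LinearMap.mulRight 𝕜 g) α.lin (x * (1 ⊗ₜ 𝓗.l.s a)) =
        α.tau a * pairing (α.sigma ∘ₗ LinearMap.mulRight 𝕜 g) α.lin x := by
      clear hx key h1
      induction x with
      | zero => simp
      | add x y hx hy => simp only [map_add, add_mul, mul_add, hx, hy]
      | tmul m n => simp [lin_mul_t, mul_left_comm]
    rw [pairing_sub_left, pairing_smul_left, LinearMap.sub_apply, LinearMap.smul_apply, h1,
      key, h2, smul_eq_mul, sub_self]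

theorem sigma_t_mul (a : A) (h : H) : α.sigma (𝓗.l.s a * h) = a * α.sigma h := by
  simpa using α.sigma_mul_t_mul 1 a h

/-- α(1)ε_r is the left convolution of σ and α. As Δ_l(t(a)h) = t(a)h₁ ⊗ h₂, the factor a comes out
of σ. -/
theorem lin_one_mul_r_counit_t_mul (a : A) (h : H) :
    α.lin 1 * 𝓗.r.counit (𝓗.l.s a * h) = α.lin 1 * (a * 𝓗.r.counit h) := by
  obtain ⟨x, hx⟩ := exists_isLeftRep (𝓗 := 𝓗) h
  rw [mul_left_comm, ← α.pairing_sigma_lin hx, ← α.pairing_sigma_lin ((isLeftRep_s_l a).mul hx)]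
  clear hx
  induction x with
  | zero => simp
  | add x y hx hy => simp only [map_add, mul_add, hx, hy]
  | tmul m n => simp [sigma_t_mul, mul_assoc]

theorem lin_one_mul_r_counit_mul (h g : H) :
    α.lin 1 * 𝓗.r.counit (h * g) = α.lin 1 * 𝓗.r.counit h * 𝓗.r.counit g := by
  rw [r_counit_mul, lin_one_mul_r_counit_t_mul, mul_assoc]

theorem sigma_mul (h g : H) : α.sigma (h * g) = α.sigma h * α.sigma g := by
  -- Cancellation in g: it suffices to compare σ(hg₁)α(g₂) with σ(h)σ(g₁)α(g₂).
  refine sub_eq_zero.1 <| α.eq_zero_of_pairing_lin_right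
    (F := α.sigma ∘ₗ LinearMap.mulLeft 𝕜 h - α.sigma h • α.sigma)
    (fun b g => ?_) (fun g y hy => ?_) g
  · simp only [LinearMap.sub_apply, LinearMap.smul_apply, LinearMap.comp_apply,
      LinearMap.mulLeft_apply, smul_eq_mul, ← mul_assoc, sigma_mul_s_mul, sigma_s_mul]
    ring
  rw [pairing_sub_left, pairing_smul_left, LinearMap.sub_apply, LinearMap.smul_apply, smul_eq_mul]
  have e1 : ∀ (h : H), pairing (α.sigma ∘ₗ LinearMap.mulLeft 𝕜 h) α.lin y =
      pairing α.sigma α.lin ((h ⊗ₜ 1) * y) := fun h => by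
    clear hy
    induction y with
    | zero => simp
    | add x y hx hy => simp only [map_add, mul_add, hx, hy]
    | tmul m n => simp
  rw [e1]
  -- Cancellation in h, with the representative y of Δ_l(g) fixed: after this second convolution
  -- both sides equal α(1)ε_r(h)ε_r(g).
  have e2 := α.eq_zero_of_pairing_lin_right
    (F := pairing α.sigma α.lin ∘ₗ LinearMap.mulRight 𝕜 y ∘ₗ (TensorProduct.mk 𝕜 H H).flip 1 -
      pairing α.sigma α.lin y • α.sigma) (fun b h => ?_) (fun h x hx => ?_) h
  · simpa [mul_comm] using e2
  · simp only [LinearMap.sub_apply, LinearMap.smul_apply, LinearMap.comp_apply,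
      LinearMap.mulRight_apply, smul_eq_mul, LinearMap.flip_apply, TensorProduct.mk_apply, ← e1,
      sigma_s_mul, mul_sub]
    congr 1
    · clear e1 hy
      induction y with
      | zero => simp
      | add x y hx hy => simp only [map_add, mul_add, hx, hy]
      | tmul m n => simp [mul_assoc, sigma_s_mul]
    · ring
  · rw [pairing_sub_left, pairing_smul_left, LinearMap.sub_apply, LinearMap.smul_apply,
      smul_eq_mul, sub_eq_zero]
    trans pairing α.sigma α.lin (x * y)
    · clear e1 hx hy
      induction x with
      | zero => simp
      | add x y hx hy => simp only [map_add, add_mul, hx, hy]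
      | tmul m n =>
        induction y with
        | zero => simp
        | add x y hx hy =>
          simp only [pairing_tmul, LinearMap.comp_apply, LinearMap.mulRight_apply, mul_add,
            map_add, add_mul, LinearMap.flip_apply, TensorProduct.mk_apply] at hx hy ⊢
          rw [hx, hy]
        | tmul m' n' => simp [lin_mul]; ring
    · rw [α.pairing_sigma_lin (hx.mul hy), α.pairing_sigma_lin hx, α.pairing_sigma_lin hy,
        lin_one_mul_r_counit_mul, mul_mul_mul_comm, lin_one_mul]
      ring

/-- On the domain of `α`, the antipode intertwines the two counits. -/
theorem lin_one_mul_r_counit_S (h : H) :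
    α.lin 1 * 𝓗.r.counit (𝓗.S h) = α.lin 1 * 𝓗.l.counit h := by
  obtain ⟨x, hx⟩ := exists_isRightRep (𝓗 := 𝓗) h
  -- Up to the factor α(1), ε_l(h) = ε_r(t(ε_l(h))) = ε_r(h¹S(h²)) = ε_r(h¹)ε_r(S(h²)), and the
  -- counit law contracts the last expression to ε_r(S(h)).
  have h1 : α.lin 1 * 𝓗.l.counit h = α.lin 1 * 𝓗.r.counit (𝓗.l.s (𝓗.l.counit h)) := by
    have := α.lin_one_mul_r_counit_t_mul (𝓗.l.counit h) 1
    rw [mul_one] at this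
    linear_combination -this - 𝓗.l.counit h * α.lin_one_mul_r_counit_one
  have hF : ∀ (a : A) (h : H), (α.lin 1 • (𝓗.r.counit ∘ₗ 𝓗.S)) (h * 𝓗.l.s a) =
      LinearMap.id (R := 𝕜) a * (α.lin 1 • (𝓗.r.counit ∘ₗ 𝓗.S)) h := fun a h => by
    simp only [LinearMap.smul_apply, LinearMap.comp_apply, smul_eq_mul, LinearMap.id_apply,
      S_mul_s_l]
    have h2 : 𝓗.r.counit (𝓗.r.s a) = a * 𝓗.r.counit 1 := by
      simpa using r_counit_mul_s_r (𝓗 := 𝓗) a 1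
    rw [r_counit_mul, h2, lin_one_mul_r_counit_t_mul]
    linear_combination a * 𝓗.r.counit (𝓗.S h) * α.lin_one_mul_r_counit_one
  have h3 := pairing_counit_left_r hF hx
  rw [h1, ← 𝓗.antipode_right h x hx]
  refine h3.symm.trans ?_
  clear h3 hx
  induction x with
  | zero => simp
  | add x y hx hy => simp only [map_add, mul_add, hx, hy]
  | tmul m n =>
    simp only [pairing_tmul, LinearMap.comp_apply, LinearMap.id_apply, LinearMap.smul_apply,
      smul_eq_mul, TensorProduct.map_tmul, LinearMap.mul'_apply, lin_one_mul_r_counit_mul]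
    ring

/-- S turns right multiplication by t(a) into left multiplication by s(a), where the
multiplicativity of ε_r up to α(1) applies. -/
theorem lin_one_mul_l_counit_mul_t (a : A) (h : H) :
    α.lin 1 * 𝓗.l.counit (h * 𝓗.l.s a) = α.lin 1 * (a * 𝓗.l.counit h) := by
  have h2 : 𝓗.r.counit (𝓗.r.s a) = a * 𝓗.r.counit 1 := by
    simpa using r_counit_mul_s_r (𝓗 := 𝓗) a 1
  rw [← lin_one_mul_r_counit_S, S_mul_s_l, lin_one_mul_r_counit_mul, h2, mul_left_comm (α.lin 1),
    lin_one_mul_r_counit_one, mul_assoc, lin_one_mul_r_counit_S, mul_left_comm]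

theorem lin_one_mul_l_counit_mul (h g : H) :
    α.lin 1 * 𝓗.l.counit (h * g) = α.lin 1 * 𝓗.l.counit h * 𝓗.l.counit g := by
  rw [𝓗.l.counit_mul_s, lin_one_mul_l_counit_mul_t]
  ring

theorem lin_one_mul_l_counit_one : α.lin 1 * 𝓗.l.counit 1 = α.lin 1 := by
  rw [← lin_one_mul_r_counit_S, S_one, lin_one_mul_r_counit_one]

theorem counitOn_mul (h g : H) : α.counitOn (h * g) = α.counitOn h * α.counitOn g := by
  simp only [counitOn_apply]
  rw [lin_one_mul_l_counit_mul, mul_mul_mul_comm, lin_one_mul, mul_assoc]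

theorem counitOn_mul_s (a : A) (h : H) : α.counitOn (h * 𝓗.r.s a) = a * α.counitOn h := by
  have h2 : 𝓗.l.counit (𝓗.r.s a) = a * 𝓗.l.counit 1 := by
    simpa using l_counit_s_r_mul (𝓗 := 𝓗) a 1
  rw [counitOn_mul, counitOn_apply _ (𝓗.r.s a), h2, mul_left_comm (α.lin 1),
    lin_one_mul_l_counit_one, counitOn_apply, mul_comm, mul_assoc, ← mul_assoc (α.lin 1),
    lin_one_mul]

theorem rightBalanced_counitOn_sigma : 𝓗.RightBalanced α.counitOn α.sigma := fun a h k => by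
  rw [counitOn_mul_s, sigma_mul_t]; ring

/-- The functional `h ↦ α(S(ε_l(h¹) ▷ h²))`. -/
def twistedSigma : H →ₗ[𝕜] A := α.rightBalanced_counitOn_sigma.conv

theorem twistedSigma_eq {h : H} {x : H ⊗[𝕜] H} (hx : 𝓗.IsRightRep h x) :
    α.twistedSigma h = pairing α.counitOn α.sigma x := RightBalanced.conv_eq _ hx

theorem twistedSigma_eq_actBy {h : H} {x : H ⊗[𝕜] H} (hx : 𝓗.IsRightRep h x) :
    α.twistedSigma h = α.lin (𝓗.S (𝓗.l.actBy 𝓗.l.counit x)) := by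
  rw [α.twistedSigma_eq hx]
  clear hx
  induction x with
  | zero => simp
  | add x y hx hy => simp only [map_add, hx, hy]
  | tmul m n =>
    simp [LeftBialgebroid.actBy, ← sigma_apply, sigma_t_mul, counitOn_apply, mul_assoc]
    rw [mul_left_comm, lin_one_mul_sigma]

theorem twistedSigma_mul (h g : H) :
    α.twistedSigma (h * g) = α.twistedSigma h * α.twistedSigma g := by
  obtain ⟨x, hx⟩ := exists_isRightRep (𝓗 := 𝓗) h
  obtain ⟨y, hy⟩ := exists_isRightRep (𝓗 := 𝓗) g
  rw [α.twistedSigma_eq hx, α.twistedSigma_eq hy, α.twistedSigma_eq (hx.mul hy),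
    pairing_mul α.counitOn_mul α.sigma_mul]

theorem lin_one_mul_twistedSigma (h : H) : α.lin 1 * α.twistedSigma h = α.twistedSigma h := by
  obtain ⟨x, hx⟩ := exists_isRightRep (𝓗 := 𝓗) h
  rw [α.twistedSigma_eq_actBy hx, lin_one_mul]

theorem twistedSigma_s (a : A) : α.twistedSigma (𝓗.r.s a) = α.tau a := by
  have h1 := α.sigma_s_mul a 1
  rw [mul_one, sigma_one, mul_comm, lin_one_mul_tau] at h1
  rw [α.twistedSigma_eq (isRightRep_s_r a), pairing_tmul, counitOn_apply,
    lin_one_mul_l_counit_one, h1, lin_one_mul_tau]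

theorem twistedSigma_t (a : A) : α.twistedSigma (𝓗.l.s a) = α.lin 1 * a := by
  have h1 := l_counit_s_l_mul (𝓗 := 𝓗) a 1
  rw [mul_one] at h1
  rw [α.twistedSigma_eq (isRightRep_s_l a), pairing_tmul, counitOn_apply, h1, sigma_one,
    mul_left_comm, lin_one_mul_l_counit_one, mul_assoc, lin_one_mul, mul_comm]

end Biretraction

/-! ### The idempotent e^α and the inverse of τ -/

namespace Biretraction

open HopfAlgebroid

variable {𝕜 A H : Type*} [Field 𝕜] [CommRing A] [Algebra 𝕜 A] [Ring H] [Algebra 𝕜 H]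
  {𝓗 : HopfAlgebroid 𝕜 A A H}

theorem mem_span_singleton_iff_of_idem {e : A} (he : e * e = e) {a : A} :
    a ∈ (Ideal.span {e} : Ideal A) ↔ e * a = a := by
  rw [Ideal.mem_span_singleton]
  refine ⟨?_, fun h => ⟨a, h.symm⟩⟩
  rintro ⟨b, rfl⟩
  rw [← mul_assoc, he]

theorem leftBalanced_tau_comp_lin (α β : Biretraction 𝓗) :
    𝓗.LeftBalanced (β.tau ∘ₗ α.lin) β.lin := fun a h k => by
  rw [LinearMap.comp_apply, lin_s_mul, tau_mul, lin_t_mul, LinearMap.comp_apply]; ring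

section Idempotent

variable (α : Biretraction 𝓗)

theorem lin_one_mul_self : α.lin 1 * α.lin 1 = α.lin 1 := α.lin_one_mul 1

theorem lin_one_mul_mul_eq (a : A) : α.lin 1 * (a * α.lin 1) = a * α.lin 1 := by
  rw [mul_left_comm, lin_one_mul_self]

variable [𝓗.IsFlipped]

theorem tau_idem : α.tau α.idem = α.lin 1 := by
  have := α.brt2.choose_spec.1
  rwa [IsFlipped.r_t] at this

theorem bijOn_tau : Set.BijOn α.tau (Ideal.span {α.idem} : Ideal A)
    (Ideal.span {α.lin 1} : Ideal A) :=
  α.brt2.choose_spec.2.congr fun a _ => congrArg α.toHom (IsFlipped.r_t a)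

theorem idem_mul_self : α.idem * α.idem = α.idem := by
  -- Both e^α e^α and e^α lie in Ae^α, and τ sends both to α(1).
  refine α.bijOn_tau.injOn (Ideal.mul_mem_left _ _ (Ideal.mem_span_singleton_self _))
    (Ideal.mem_span_singleton_self _) ?_
  rw [tau_mul, tau_idem, lin_one_mul_self]

theorem tau_idem_mul (a : A) : α.tau (α.idem * a) = α.tau a := by
  rw [tau_mul, tau_idem, lin_one_mul_tau]

theorem eq_of_tau_eq {a b : A} (ha : α.idem * a = a) (hb : α.idem * b = b)
    (h : α.tau a = α.tau b) : a = b :=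
  α.bijOn_tau.injOn ((mem_span_singleton_iff_of_idem α.idem_mul_self).2 ha)
    ((mem_span_singleton_iff_of_idem α.idem_mul_self).2 hb) h

theorem tInv_eq_invFunOn (b : A) :
    α.tInv b = Function.invFunOn α.tau (Ideal.span {α.idem} : Ideal A) b := by
  unfold tInv
  simp only [IsFlipped.r_t]
  rfl

theorem exists_tau_eq {b : A} (hb : α.lin 1 * b = b) :
    ∃ a ∈ ((Ideal.span {α.idem} : Ideal A) : Set A), α.tau a = b :=
  α.bijOn_tau.surjOn ((mem_span_singleton_iff_of_idem α.lin_one_mul_self).2 hb)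

theorem tau_tInv {b : A} (hb : α.lin 1 * b = b) : α.tau (α.tInv b) = b := by
  rw [tInv_eq_invFunOn]
  exact Function.invFunOn_eq (α.exists_tau_eq hb)

theorem idem_mul_tInv {b : A} (hb : α.lin 1 * b = b) : α.idem * α.tInv b = α.tInv b := by
  rw [← mem_span_singleton_iff_of_idem α.idem_mul_self, tInv_eq_invFunOn]
  exact Function.invFunOn_mem (α.exists_tau_eq hb)

/-- `tInv` is defined by choice; injectivity of τ on Ae^α makes its values on Aα(1) computable. -/
theorem tInv_eq {a b : A} (ha : α.idem * a = a) (h : α.tau a = b) : α.tInv b = a := by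
  have hb : α.lin 1 * b = b := by rw [← h, lin_one_mul_tau]
  exact α.eq_of_tau_eq (α.idem_mul_tInv hb) ha (by rw [α.tau_tInv hb, h])

theorem tInv_tau (a : A) : α.tInv (α.tau a) = α.idem * a :=
  α.tInv_eq (by rw [← mul_assoc, idem_mul_self]) (α.tau_idem_mul a)

theorem tInv_lin_one : α.tInv (α.lin 1) = α.idem := α.tInv_eq α.idem_mul_self α.tau_idem

theorem tInv_mul {a b : A} (ha : α.lin 1 * a = a) (hb : α.lin 1 * b = b) :
    α.tInv (a * b) = α.tInv a * α.tInv b :=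
  α.tInv_eq (by rw [← mul_assoc, α.idem_mul_tInv ha])
    (by rw [tau_mul, α.tau_tInv ha, α.tau_tInv hb])

end Idempotent

/-! ### Restrictions of the counit -/

/-- The biretraction is a multiple of the left counit. -/
def IsCounital (ι : Biretraction 𝓗) : Prop := ∀ h, ι.lin h = ι.lin 1 * 𝓗.l.counit h

/-- The value at 1 is qε_l(1), not visibly q; but ε_l(1)ε_l(h) = ε_l(t(ε_l(1))h) = ε_l(h). -/
theorem isCounital_of_eq {ι : Biretraction 𝓗} (q : A) (h : ∀ h, ι.lin h = q * 𝓗.l.counit h) :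
    ι.IsCounital := fun g => by
  rw [h 1, mul_assoc, ← l_counit_s_l_mul, s_l_counit_one, one_mul, h]

theorem IsCounital.tau_apply {ι : Biretraction 𝓗} (hι : ι.IsCounital) (a : A) :
    ι.tau a = ι.lin 1 * a := by
  have := l_counit_s_l_mul (𝓗 := 𝓗) a 1
  rw [mul_one] at this
  rw [Biretraction.tau_apply, hι, this, mul_left_comm, ← hι, mul_comm]

/-! ### Biretractions from linear functionals -/

variable [𝓗.IsFlipped]

/-- A multiplicative linear functional, with an idempotent `e`, defines a local biretraction. -/
def ofLinear (F : H →ₗ[𝕜] A) (hmul : ∀ h g, F (h * g) = F h * F g)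
    (hs : ∀ a, F (𝓗.r.s a) = a * F 1) (e : A) (he : e * e = e) (hte : F (𝓗.l.s e) = F 1)
    (hinj : ∀ a b, e * a = a → e * b = b → F (𝓗.l.s a) = F (𝓗.l.s b) → a = b)
    (hsurj : ∀ b, F 1 * b = b → ∃ a, e * a = a ∧ F (𝓗.l.s a) = b) : Biretraction 𝓗 where
  toHom := { F with
    map_smul' := F.map_smul
    map_zero' := F.map_zero
    map_mul' := hmul }
  brt1 := hs
  brt2 := by
    have h1 : F 1 * F 1 = F 1 := by rw [← hmul, one_mul]
    refine ⟨e, by simpa [IsFlipped.r_t] using hte, ?_, ?_, ?_⟩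
    · intro a _
      refine (mem_span_singleton_iff_of_idem h1).2 ?_
      change F 1 * F (𝓗.r.t (op a)) = F (𝓗.r.t (op a))
      rw [← hmul, one_mul]
    · intro a ha b hb hab
      refine hinj a b ((mem_span_singleton_iff_of_idem he).1 ha)
        ((mem_span_singleton_iff_of_idem he).1 hb) ?_
      rw [← IsFlipped.r_t, ← IsFlipped.r_t]
      exact hab
    · intro b hb
      obtain ⟨a, ha, hab⟩ := hsurj b ((mem_span_singleton_iff_of_idem h1).1 hb)
      refine ⟨a, (mem_span_singleton_iff_of_idem he).2 ha, ?_⟩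
      rw [← IsFlipped.r_t] at hab
      exact hab

/-! ### The product -/

section Mul

variable (α β γ : Biretraction 𝓗)

/-- The functional `h ↦ β(α(h₁) ▷ h₂)`. -/
def mulLin : H →ₗ[𝕜] A := (leftBalanced_tau_comp_lin α β).conv

variable {α β} in
theorem mulLin_eq {h : H} {x : H ⊗[𝕜] H} (hx : 𝓗.IsLeftRep h x) :
    mulLin α β h = pairing (β.tau ∘ₗ α.lin) β.lin x := LeftBalanced.conv_eq _ hx

theorem mulLin_one : mulLin α β 1 = β.tau (α.lin 1) := by
  rw [mulLin_eq isLeftRep_one, pairing_tmul, mul_comm, LinearMap.comp_apply, lin_one_mul_tau β]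

theorem mulLin_t (a : A) : mulLin α β (𝓗.l.s a) = β.tau (α.tau a) := by
  rw [mulLin_eq (isLeftRep_s_l a), pairing_tmul, mul_comm]
  exact lin_one_mul_tau β _

theorem mulLin_s (a : A) : mulLin α β (𝓗.r.s a) = a * mulLin α β 1 := by
  rw [mulLin_eq (isLeftRep_s_r a), pairing_tmul, mulLin_one, lin_s, LinearMap.comp_apply,
    mul_left_comm, mul_comm _ (β.lin 1), lin_one_mul_tau]

theorem mulLin_mul (h g : H) : mulLin α β (h * g) = mulLin α β h * mulLin α β g := by
  obtain ⟨x, hx⟩ := exists_isLeftRep (𝓗 := 𝓗) h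
  obtain ⟨y, hy⟩ := exists_isLeftRep (𝓗 := 𝓗) g
  rw [mulLin_eq hx, mulLin_eq hy, mulLin_eq (hx.mul hy), pairing_mul (fun a b => ?_) β.lin_mul]
  simp [lin_mul, tau_mul]

instance : Mul (Biretraction 𝓗) where
  mul α β := ofLinear (mulLin α β) (mulLin_mul α β) (mulLin_s α β)
    -- Domain of τ_β ∘ τ_α: e^β α(1) generates the intersection of Ae^β with the range Aα(1) of τ_α,
    -- and is pulled back along τ_α.
    (α.tInv (β.idem * α.lin 1))
    (by rw [← α.tInv_mul (α.lin_one_mul_mul_eq _) (α.lin_one_mul_mul_eq _), mul_mul_mul_comm,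
      idem_mul_self, lin_one_mul_self])
    (by rw [mulLin_t, α.tau_tInv (α.lin_one_mul_mul_eq _), tau_idem_mul, mulLin_one])
    (by
      intro a b ha hb hab
      have key : ∀ c, α.tInv (β.idem * α.lin 1) * c = c →
          α.idem * c = c ∧ β.idem * α.tau c = α.tau c := by
        intro c hc
        have h0 := α.lin_one_mul_mul_eq β.idem
        constructor
        · rw [← hc, ← mul_assoc, α.idem_mul_tInv h0]
        · rw [← hc, tau_mul, α.tau_tInv h0, ← mul_assoc, ← mul_assoc, idem_mul_self]
      rw [mulLin_t, mulLin_t] at hab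
      exact α.eq_of_tau_eq (key a ha).1 (key b hb).1
        (β.eq_of_tau_eq (key a ha).2 (key b hb).2 hab))
    (by
      intro b hb
      rw [mulLin_one] at hb
      have hb1 : β.lin 1 * b = b := by rw [← hb, ← mul_assoc, lin_one_mul_tau]
      set d := β.tInv b with hd
      have h1 : β.idem * d = d := β.idem_mul_tInv hb1
      -- The preimage under τ_β must lie in the range of τ_α; injectivity of τ_β on Ae^β shows that
      -- it does.
      have h2 : α.lin 1 * d = d := by
        refine β.eq_of_tau_eq ?_ h1 ?_
        · rw [mul_left_comm, h1]
        · rw [tau_mul, hd, β.tau_tInv hb1, hb]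
      refine ⟨α.tInv d, ?_, ?_⟩
      · rw [← α.tInv_mul (α.lin_one_mul_mul_eq _) h2, mul_assoc, h2, h1]
      · rw [mulLin_t, α.tau_tInv h2, hd, β.tau_tInv hb1])

theorem lin_mul_apply (h : H) : (α * β).lin h = mulLin α β h := rfl

variable {α β} in
theorem lin_mul_eq {h : H} {x : H ⊗[𝕜] H} (hx : 𝓗.IsLeftRep h x) :
    (α * β).lin h = pairing (β.tau ∘ₗ α.lin) β.lin x := mulLin_eq hx

theorem tau_mul_apply (a : A) : (α * β).tau a = β.tau (α.tau a) := mulLin_t α β a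

instance : Semigroup (Biretraction 𝓗) where
  mul_assoc α β γ := by
    refine ext_lin fun h => ?_
    obtain ⟨x, hx⟩ := exists_isLeftRep (𝓗 := 𝓗) h
    rw [lin_mul_eq hx, lin_mul_eq hx]
    -- Both products are τ_γ(τ_β(α(h₁))) τ_γ(β(h₂)) γ(h₃), bracketed differently.
    refine pairing_coassoc_l (f := (β * γ).tau ∘ₗ α.lin) (g := γ.tau ∘ₗ β.lin)
      (fun a h k => ?_) (leftBalanced_tau_comp_lin β γ) (fun h y hy => ?_)
      (fun h y hy => lin_mul_eq hy) hx hx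
    · simp only [LinearMap.comp_apply, lin_s_mul, lin_t_mul, tau_mul_apply, tau_mul]
      ring
    · have h1 : (β * γ).tau ∘ₗ α.lin = γ.tau ∘ₗ (β.tau ∘ₗ α.lin) :=
        LinearMap.ext fun h => tau_mul_apply β γ _
      rw [h1, pairing_comp _ γ.tau_mul, LinearMap.comp_apply, LinearMap.comp_apply, lin_mul_eq hy]

theorem lin_mul_eq_actBy {h : H} {x : H ⊗[𝕜] H} (hx : 𝓗.IsLeftRep h x) :
    (α * β).lin h = β.lin (𝓗.l.actBy α.lin x) := by
  rw [lin_mul_eq hx]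
  clear hx
  induction x with
  | zero => simp
  | add x y hx hy => simp only [map_add, hx, hy]
  | tmul m n => simp [LeftBialgebroid.actBy, lin_t_mul]

end Mul

/-! ### The pseudo-inverse -/

section Star

variable (α : Biretraction 𝓗)

/-- The functional `h ↦ (α ∘ t)⁻¹(α(S(ε_l(h¹) ▷ h²)))`. -/
def starLin : H →ₗ[𝕜] A where
  toFun h := α.tInv (α.twistedSigma h)
  -- Linearity holds because the values of `twistedSigma` lie in Aα(1), where the preimage in Ae^α
  -- is unique.
  map_add' h g := α.tInv_eq
    (by rw [mul_add, α.idem_mul_tInv (α.lin_one_mul_twistedSigma _),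
      α.idem_mul_tInv (α.lin_one_mul_twistedSigma _)])
    (by rw [map_add, map_add, α.tau_tInv (α.lin_one_mul_twistedSigma _),
      α.tau_tInv (α.lin_one_mul_twistedSigma _)])
  map_smul' c h := α.tInv_eq
    (by rw [RingHom.id_apply, mul_smul_comm, α.idem_mul_tInv (α.lin_one_mul_twistedSigma _)])
    (by rw [RingHom.id_apply, map_smul, map_smul, α.tau_tInv (α.lin_one_mul_twistedSigma _)])

theorem starLin_apply (h : H) : α.starLin h = α.tInv (α.twistedSigma h) := rfl

theorem tau_starLin (h : H) : α.tau (α.starLin h) = α.twistedSigma h :=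
  α.tau_tInv (α.lin_one_mul_twistedSigma h)

theorem idem_mul_starLin (h : H) : α.idem * α.starLin h = α.starLin h :=
  α.idem_mul_tInv (α.lin_one_mul_twistedSigma h)

theorem starLin_mul (h g : H) : α.starLin (h * g) = α.starLin h * α.starLin g := by
  rw [starLin_apply, twistedSigma_mul, tInv_mul _ (α.lin_one_mul_twistedSigma h)
    (α.lin_one_mul_twistedSigma g)]
  rfl

theorem starLin_s (a : A) : α.starLin (𝓗.r.s a) = α.idem * a := by
  rw [starLin_apply, twistedSigma_s, tInv_tau]

theorem starLin_one : α.starLin 1 = α.idem := by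
  simpa using α.starLin_s 1

theorem starLin_t (a : A) : α.starLin (𝓗.l.s a) = α.tInv (α.lin 1 * a) := by
  rw [starLin_apply, twistedSigma_t]

/-- The local biretraction `α*`. -/
def star : Biretraction 𝓗 :=
  ofLinear α.starLin α.starLin_mul (fun a => by rw [starLin_s, starLin_one, mul_comm])
    -- Passing to the inverse bijection exchanges e^α and α(1).
    (α.lin 1) α.lin_one_mul_self
    (by rw [starLin_t, lin_one_mul_self, tInv_lin_one, starLin_one])
    (by
      intro a b ha hb hab
      rw [starLin_t, starLin_t, ha, hb] at hab
      rw [← α.tau_tInv ha, hab, α.tau_tInv hb])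
    (by
      intro b hb
      rw [starLin_one] at hb
      exact ⟨α.tau b, α.lin_one_mul_tau b, by rw [starLin_t, lin_one_mul_tau, tInv_tau, hb]⟩)

theorem lin_star (h : H) : α.star.lin h = α.starLin h := rfl

theorem tau_star (a : A) : α.star.tau a = α.tInv (α.lin 1 * a) := α.starLin_t a

/-- Both sides lie in Ae^α, so τ may be applied. The left side becomes α(h₁)·α(1)ε_l(h₂¹)·σ(h₂²),
which regroups by mixed coassociativity to α(h¹)σ(h²) = τ(ε_l(h)). -/
theorem lin_mul_star (h : H) : (α * α.star).lin h = α.idem * 𝓗.l.counit h := by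
  obtain ⟨x, hx⟩ := exists_isLeftRep (𝓗 := 𝓗) h
  obtain ⟨y, hy⟩ := exists_isRightRep (𝓗 := 𝓗) h
  rw [← tInv_tau]
  refine (α.tInv_eq ?_ ?_).symm
  · rw [← (α * α.star).lin_one_mul, ← mul_assoc]
    congr 1
    rw [lin_mul_apply, mulLin_one, tau_star, lin_one_mul_self, tInv_lin_one, idem_mul_self]
  have h1 : (α.tau ∘ₗ (α.star.tau ∘ₗ α.lin)) = α.lin := LinearMap.ext fun h => by
    simp only [LinearMap.comp_apply]
    rw [tau_star, lin_one_mul, α.tau_tInv (α.lin_one_mul h)]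
  have h2 : α.tau ∘ₗ α.star.lin = α.twistedSigma := LinearMap.ext fun h => α.tau_starLin h
  rw [lin_mul_eq hx, ← LinearMap.comp_apply, ← pairing_comp _ α.tau_mul, h1, h2,
    ← α.pairing_lin_sigma hy]
  refine (pairing_coassoc_lr (fun a h k => ?_) α.rightBalanced_counitOn_sigma (fun h z hz => ?_)
    (fun h z hz => α.twistedSigma_eq hz) hy hx).symm
  · rw [lin_s_mul, counitOn_apply, counitOn_apply, l_counit_s_l_mul]
    ring
  · have h3 : α.counitOn = LinearMap.mulLeft 𝕜 (α.lin 1) ∘ₗ 𝓗.l.counit := rfl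
    rw [h3, pairing_counit_right_l (fun a g => ?_) hz]
    rw [lin_s_mul, LinearMap.mulLeft_apply, mul_right_comm, lin_one_mul, mul_comm]

/-- The twist by ε_l matters here: σ alone would give σ(h₁)α(h₂) = α(1)ε_r(h), whereas the twist
yields α(1)ε_l(h¹)ε_r(h²), which the right counit law contracts to α(1)ε_l(h). -/
theorem lin_star_mul (h : H) : (α.star * α).lin h = α.lin 1 * 𝓗.l.counit h := by
  obtain ⟨x, hx⟩ := exists_isLeftRep (𝓗 := 𝓗) h
  obtain ⟨y, hy⟩ := exists_isRightRep (𝓗 := 𝓗) h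
  have h2 : α.tau ∘ₗ α.star.lin = α.twistedSigma := LinearMap.ext fun h => α.tau_starLin h
  rw [lin_mul_eq hx, h2]
  rw [pairing_coassoc_rl α.rightBalanced_counitOn_sigma α.leftBalanced_sigma_lin
    (k' := LinearMap.mulLeft 𝕜 (α.lin 1) ∘ₗ 𝓗.r.counit) (fun h z hz => α.twistedSigma_eq hz)
    (fun h z hz => (α.pairing_sigma_lin hz).symm) hx hy, ← counitOn_apply,
    pairing_counit_right_r (fun a g => ?_) hy]
  rw [counitOn_mul_s, LinearMap.mulLeft_apply, counitOn_apply]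
  linear_combination (-a * 𝓗.l.counit g) * α.lin_one_mul_self

theorem lin_star_eq {h : H} {x : H ⊗[𝕜] H} (hx : 𝓗.IsRightRep h x) :
    α.star.lin h = α.tInv (α.lin (𝓗.S (𝓗.l.actBy 𝓗.l.counit x))) := by
  rw [lin_star, starLin_apply, α.twistedSigma_eq_actBy hx]

end Star

/-! ### Idempotents -/

/-- The factor τ_β(ι(1)) comes out and the counit law contracts τ_β(ε_l(h₁))β(h₂) to β(h). -/
theorem IsCounital.lin_mul_apply {ι : Biretraction 𝓗} (hι : ι.IsCounital) (β : Biretraction 𝓗)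
    (h : H) : (ι * β).lin h = β.tau (ι.lin 1) * β.lin h := by
  obtain ⟨x, hx⟩ := exists_isLeftRep (𝓗 := 𝓗) h
  have h1 : β.tau ∘ₗ ι.lin = β.tau (ι.lin 1) • (β.tau ∘ₗ 𝓗.l.counit) :=
    LinearMap.ext fun h => by simp [hι h, tau_mul]
  rw [lin_mul_eq hx, h1, pairing_smul_left, LinearMap.smul_apply, smul_eq_mul,
    pairing_counit_left_l β.lin_t_mul hx]

theorem IsCounital.lin_mul_apply_of_isCounital {ι κ : Biretraction 𝓗} (hι : ι.IsCounital)
    (hκ : κ.IsCounital) (h : H) : (ι * κ).lin h = κ.lin 1 * ι.lin 1 * 𝓗.l.counit h := by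
  rw [hι.lin_mul_apply, hκ.tau_apply, hκ h]
  linear_combination ι.lin 1 * 𝓗.l.counit h * κ.lin_one_mul_self

theorem IsCounital.mul {ι κ : Biretraction 𝓗} (hι : ι.IsCounital) (hκ : κ.IsCounital) :
    (ι * κ).IsCounital :=
  isCounital_of_eq _ (hι.lin_mul_apply_of_isCounital hκ)

theorem IsCounital.mul_comm {ι κ : Biretraction 𝓗} (hι : ι.IsCounital) (hκ : κ.IsCounital) :
    ι * κ = κ * ι :=
  ext_lin fun h => by
    rw [hι.lin_mul_apply_of_isCounital hκ, hκ.lin_mul_apply_of_isCounital hι,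
      _root_.mul_comm (κ.lin 1)]

theorem isCounital_mul_star (α : Biretraction 𝓗) : (α * α.star).IsCounital :=
  isCounital_of_eq _ α.lin_mul_star

theorem isCounital_star_mul (α : Biretraction 𝓗) : (α.star * α).IsCounital :=
  isCounital_of_eq _ α.lin_star_mul

theorem lin_one_mul_star (α : Biretraction 𝓗) : (α * α.star).lin 1 = α.idem := by
  rw [lin_mul_apply, mulLin_one, tau_star, lin_one_mul_self, tInv_lin_one]

theorem mul_star_mul (α : Biretraction 𝓗) : α * α.star * α = α :=
  ext_lin fun h => by
    rw [α.isCounital_mul_star.lin_mul_apply, lin_one_mul_star, tau_idem, lin_one_mul]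

theorem star_mul_star (α : Biretraction 𝓗) : α.star * α * α.star = α.star :=
  ext_lin fun h => by
    have h1 : (α.star * α).lin 1 = α.lin 1 := by
      rw [lin_star_mul, lin_one_mul_l_counit_one]
    rw [α.isCounital_star_mul.lin_mul_apply, h1, tau_star, lin_one_mul_self, tInv_lin_one, lin_star,
      idem_mul_starLin]

end Biretraction

/-! ### Inverse semigroups and their algebras -/

section InverseSemigroup

variable {G : Type*} [Semigroup G]

/-- Two generalized inverses of an element agree if idempotents commute. -/
theorem eq_of_generalizedInverse (hE : ∀ e f : G, e * e = e → f * f = f → e * f = f * e)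
    {a b c : G} (h1 : a * b * a = a) (h2 : b * a * b = b) (h3 : a * c * a = a)
    (h4 : c * a * c = c) : b = c := by
  have hab : a * b * (a * b) = a * b := by rw [← mul_assoc, h1]
  have hba : b * a * (b * a) = b * a := by rw [← mul_assoc, h2]
  have hac : a * c * (a * c) = a * c := by rw [← mul_assoc, h3]
  have hca : c * a * (c * a) = c * a := by rw [← mul_assoc, h4]
  calc b = b * a * (c * a) * b := by
          rw [mul_assoc b a, ← mul_assoc a, h3, h2]
    _ = c * a * (b * a) * b := by rw [hE _ _ hba hca]
    _ = c * (a * b * a) * b := by simp only [mul_assoc]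
    _ = c * (a * c * a) * b := by rw [h1, h3]
    _ = c * ((a * c) * (a * b)) := by simp only [mul_assoc]
    _ = c * ((a * b) * (a * c)) := by rw [hE _ _ hac hab]
    _ = c * (a * b * a) * c := by simp only [mul_assoc]
    _ = c := by rw [h1, h4]

/-- A generalized inverse operation is antimultiplicative if the elements `x x*` and `x* x` lie
in a commutative subsemigroup. -/
theorem star_mul_of_commute (star : G → G) (h1 : ∀ x, x * star x * x = x)
    (h2 : ∀ x, star x * x * star x = star x) (C : G → Prop)
    (hC : ∀ x y, C x → C y → x * y = y * x) (hCmul : ∀ x y, C x → C y → C (x * y))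
    (hC1 : ∀ x, C (x * star x)) (hC2 : ∀ x, C (star x * x)) (x y : G) :
    star (x * y) = star y * star x := by
  have idem : ∀ e : G, e * e = e → C e := by
    intro e he
    -- For idempotent e this writes e* as a product of two commuting idempotents, so e* is
    -- idempotent; then e = e e* e* e is a product of two elements of C.
    have h : star e = star e * e * (e * star e) := by
      rw [mul_assoc (star e), ← mul_assoc e, he, ← mul_assoc, h2]
    have h1' : e * star e * (e * star e) = e * star e := by rw [← mul_assoc, h1]
    have h2' : star e * e * (star e * e) = star e * e := by rw [← mul_assoc, h2]
    have hs : star e * star e = star e := by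
      rw [h]
      exact IsIdempotentElem.mul_of_commute (hC _ _ (hC2 e) (hC1 e)) h2' h1'
    have h' : e = e * star e * (star e * e) := by
      rw [← mul_assoc, mul_assoc e, hs, h1]
    rw [h']
    exact hCmul _ _ (hC1 e) (hC2 e)
  have hE : ∀ e f : G, e * e = e → f * f = f → e * f = f * e := fun e f he hf =>
    hC _ _ (idem e he) (idem f hf)
  have hxy := hC _ _ (hC1 y) (hC2 x)
  refine eq_of_generalizedInverse hE (h1 _) (h2 _) ?_ ?_
  · calc x * y * (star y * star x) * (x * y) = x * (y * star y * (star x * x)) * y := by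
          simp only [mul_assoc]
      _ = x * star x * x * (y * star y * y) := by rw [hxy]; simp only [mul_assoc]
      _ = x * y := by rw [h1, h1]
  · calc star y * star x * (x * y) * (star y * star x)
        = star y * (star x * x * (y * star y)) * star x := by simp only [mul_assoc]
      _ = star y * y * star y * (star x * x * star x) := by rw [← hxy]; simp only [mul_assoc]
      _ = star y * star x := by rw [h2, h2]

end InverseSemigroup

/-! ### Semigroup algebras -/

section SemigroupAlgebra

variable {𝕜 G V : Type*} [Field 𝕜] [AddCommGroup V] [Module 𝕜 V]

@[simp]
theorem linExt_single (f : G → V) (g : G) (c : 𝕜) :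
    linExt 𝕜 f (MonoidAlgebra.single g c) = c • f g := by
  simp [linExt, MonoidAlgebra.coeffLinearEquiv]

theorem monoidAlgebra_linearMap_ext {f g : MonoidAlgebra 𝕜 G →ₗ[𝕜] V}
    (h : ∀ x, f (MonoidAlgebra.single x 1) = g (MonoidAlgebra.single x 1)) : f = g :=
  MonoidAlgebra.lhom_ext' fun x => LinearMap.ext_ring (h x)

-- On group-like elements convolution is the pointwise product, so the convolution axioms become
-- semigroup identities.
variable (𝕜) in
theorem convEnd_groupLikeComul_single [Semigroup G]
    (f g : MonoidAlgebra 𝕜 G →ₗ[𝕜] MonoidAlgebra 𝕜 G) (x : G) :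
    convEnd (groupLikeComul 𝕜 G) f g (MonoidAlgebra.single x 1) =
      f (MonoidAlgebra.single x 1) * g (MonoidAlgebra.single x 1) := by
  simp [convEnd, groupLikeComul]

/-- Two bilinear maps on `𝕜G` agree if they agree on `G`. -/
theorem monoidAlgebra_bilinear_ext {f g : MonoidAlgebra 𝕜 G →ₗ[𝕜] MonoidAlgebra 𝕜 G →ₗ[𝕜] V}
    (h : ∀ x y, f (MonoidAlgebra.single x 1) (MonoidAlgebra.single y 1) =
      g (MonoidAlgebra.single x 1) (MonoidAlgebra.single y 1)) (x y : MonoidAlgebra 𝕜 G) :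
    f x y = g x y := by
  have : f = g := monoidAlgebra_linearMap_ext fun x => monoidAlgebra_linearMap_ext (h x)
  rw [this]

/-- The algebra of an inverse semigroup is a quantum inverse semigroup. -/
theorem isQuantumInverseSemigroup_semigroupAlgebra [Semigroup G] (star : G → G)
    (h1 : ∀ x, x * star x * x = x) (h2 : ∀ x, star x * x * star x = star x)
    (h3 : ∀ x y, star (x * y) = star y * star x)
    (h4 : ∀ x y, x * star x * (star y * y) = star y * y * (x * star x)) :
    IsQuantumInverseSemigroup (Q := MonoidAlgebra 𝕜 G) (groupLikeComul 𝕜 G)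
      (starExt 𝕜 star) where
  comul_mul := monoidAlgebra_bilinear_ext
    (f := (LinearMap.mul 𝕜 (MonoidAlgebra 𝕜 G)).compr₂ (groupLikeComul 𝕜 G))
    (g := (LinearMap.mul 𝕜 (MonoidAlgebra 𝕜 G ⊗[𝕜] MonoidAlgebra 𝕜 G)).compl₁₂
      (groupLikeComul 𝕜 G) (groupLikeComul 𝕜 G))
    fun x y => by simp [groupLikeComul, MonoidAlgebra.single_mul_single]
  coassoc := monoidAlgebra_linearMap_ext fun x => by simp [groupLikeComul]
  antipode_mul := monoidAlgebra_bilinear_ext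
    (f := (LinearMap.mul 𝕜 (MonoidAlgebra 𝕜 G)).compr₂ (starExt 𝕜 star))
    (g := (LinearMap.mul 𝕜 (MonoidAlgebra 𝕜 G)).flip.compl₁₂ (starExt 𝕜 star) (starExt 𝕜 star))
    fun x y => by simp [starExt, MonoidAlgebra.single_mul_single, h3]
  conv_id_S_id := monoidAlgebra_linearMap_ext fun x => by
    simp [convEnd_groupLikeComul_single, starExt, MonoidAlgebra.single_mul_single, h1]
  conv_S_id_S := monoidAlgebra_linearMap_ext fun x => by
    simp [convEnd_groupLikeComul_single, starExt, MonoidAlgebra.single_mul_single, h2]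
  comm := monoidAlgebra_bilinear_ext
    (f := (LinearMap.mul 𝕜 (MonoidAlgebra 𝕜 G)).compl₁₂
      (convEnd (groupLikeComul 𝕜 G) LinearMap.id (starExt 𝕜 star))
      (convEnd (groupLikeComul 𝕜 G) (starExt 𝕜 star) LinearMap.id))
    (g := (LinearMap.mul 𝕜 (MonoidAlgebra 𝕜 G)).flip.compl₁₂
      (convEnd (groupLikeComul 𝕜 G) LinearMap.id (starExt 𝕜 star))
      (convEnd (groupLikeComul 𝕜 G) (starExt 𝕜 star) LinearMap.id))
    fun x y => by
      simp [convEnd_groupLikeComul_single, starExt, MonoidAlgebra.single_mul_single, h4]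

end SemigroupAlgebra

end

theorem mainTheorem4 {𝕜 A H : Type*} [Field 𝕜] [CharZero 𝕜] [CommRing A] [Algebra 𝕜 A]
    [Ring H] [Algebra 𝕜 H] (𝓗 : HopfAlgebroid 𝕜 A A H)
    (hst : ∀ a : A, 𝓗.l.s a = 𝓗.r.t (op a)) (hts : ∀ a : A, 𝓗.r.s a = 𝓗.l.t (op a)) :
    ∃ (_ : Semigroup (Biretraction 𝓗)) (star : Biretraction 𝓗 → Biretraction 𝓗),
      -- `(α ∗ β)(h) = β(α(h₁) ▷ h₂)`, where `Δ_l(h) = h₁ ⊗ h₂`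
      (∀ (α β : Biretraction 𝓗) (h : H) (x : H ⊗[𝕜] H),
        Submodule.mkQ _ x = 𝓗.l.comul h → (α * β).lin h = β.lin (𝓗.l.actBy α.lin x)) ∧
      -- `α*(h) = (α ∘ t)⁻¹(α(S(ε_l(h¹) ▷ h²)))`, where `Δ_r(h) = h¹ ⊗ h²`
      (∀ (α : Biretraction 𝓗) (h : H) (x : H ⊗[𝕜] H),
        Submodule.mkQ _ x = 𝓗.r.comul h →
          (star α).lin h = α.tInv (α.lin (𝓗.S (𝓗.l.actBy 𝓗.l.counit x)))) ∧
      IsQuantumInverseSemigroup (Q := MonoidAlgebra 𝕜 (Biretraction 𝓗))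
        (groupLikeComul 𝕜 (Biretraction 𝓗)) (starExt 𝕜 star) := by
  have : 𝓗.IsFlipped := ⟨fun a => (hst a).symm, fun a => (hts a).symm⟩
  exact ⟨inferInstance, Biretraction.star, fun α β _ _ hx => Biretraction.lin_mul_eq_actBy α β hx,
    fun α _ _ hx => α.lin_star_eq hx,
    isQuantumInverseSemigroup_semigroupAlgebra _ Biretraction.mul_star_mul
      Biretraction.star_mul_star
      (star_mul_of_commute _ Biretraction.mul_star_mul Biretraction.star_mul_star
        Biretraction.IsCounital (fun _ _ hx hy => hx.mul_comm hy) (fun _ _ hx hy => hx.mul hy)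
        Biretraction.isCounital_mul_star Biretraction.isCounital_star_mul)
      fun α β => α.isCounital_mul_star.mul_comm β.isCounital_star_mul⟩
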